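/- Let $g\ge 0$, let $k_1,\dots,k_{2g+1}$ be integers, and let $K=K(k_1,\dots,k_{2g+1})$ be the odd pretzel knot $P(2k_1+1,\dots,2k_{2g+1}+1)$: its standard diagram has $2g+1$ columns, the $i$-th of which consists of $|2k_i+1|$ half twists, right-handed if $k_i\ge 0$ and left-handed otherwise, and neighbouring columns (in cyclic order) are joined at the top and at the bottom. So $K(0,0,0)$ is the left-handed trefoil. Write $$s_n=\sum_{P\subseteq\{1,\dots,2g+1\},\ |P|=n}\ \prod_{j\in P}k_j$$ for the $n$-th elementary symmetric polynomial in $k_1,\dots,k_{2g+1}$ (which is $0$ if $n>2g+1$). Let $a_2(K)$ be the coefficient of $z^2$ in the Conway polynomial $\nabla_K(z)$, where $\nabla_K(t^{1/2}-t^{-1/2})=\Delta_K(t)$ is the Alexander polynomial normalized by $\Delta_K(t^{-1})=\Delta_K(t)$ and $\Delta_K(1)=1$, and let $$v_3(K)=-\tfrac1{36}V_K'''(1)-\tfrac1{12}V_K''(1),$$ where $V_K(t)$ is the Jones polynomial. Then $$a_2(K)=\tfrac12 g(g+1)+g\,s_1+s_2$$ and $$v_3(K)=-\tfrac12\left(\frac{g(g+1)(2g+1)}{3}+g(2g+1)s_1+g\,s_1^2+2g\,s_2+s_1s_2+s_3\right).$$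 -/

import Mathlib

open scoped LaurentPolynomial

/-- A diagram on the oriented sphere of an oriented knot, with crossing set `C`, given by its signed
Gauss code.  The knot runs through every crossing twice; the passage `(c, true)` is the one
along the over-strand of `c` and `(c, false)` the one along the under-strand.  After the passage
`p` the knot next runs through the passage `next p`.

The edges of the diagram are the pieces of the knot between consecutive passages.  The edge that
enters the passage `p` is also denoted by `p`; so the edge that leaves `p` is `next p`. -/
structure GaussCode (C : Type) where
  /-- The sign of a crossing: `1` (positive, right-handed) or `-1` (negative, left-handed). -/
  sign : C → ℤˣ
  /-- The passage that follows a given passage. -/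
  next : C × Bool → C × Bool

namespace GaussCode

variable {C : Type}

/-- The passages of a crossing, listed so that the second strand crosses the first one from right
to left: the over-strand comes first at a positive crossing, the under-strand at a negative
one. -/
def first (D : GaussCode C) (c : C) : C × Bool := (c, decide (D.sign c = 1))

/-- The other passage of a crossing, see `GaussCode.first`. -/
def second (D : GaussCode C) (c : C) : C × Bool := (c, !decide (D.sign c = 1))

/-- The sides of the edges are pairs `(e, s)`, with `s = true` for the left-hand and `s = false`
for the right-hand side of `e`.  Two sides are adjacent if they meet in one of the four corners
at a crossing. -/
inductive SideAdj (D : GaussCode C) : (C × Bool) × Bool → (C × Bool) × Bool → Prop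
  | ahead (c : C) : SideAdj D (D.next (D.first c), true) (D.next (D.second c), false)
  | left (c : C) : SideAdj D (D.next (D.second c), true) (D.first c, true)
  | behind (c : C) : SideAdj D (D.first c, false) (D.second c, true)
  | right (c : C) : SideAdj D (D.second c, false) (D.next (D.first c), false)

/-- The regions of the diagram: walks along sides of edges, turning at the corners. -/
def Region (D : GaussCode C) : Type := Quot D.SideAdj

end GaussCode

/-- A knot diagram on the sphere: a signed Gauss code that runs through all the passages in one
cycle (so there is one component) and that is planar.  By Euler's formula the latter says that
there are two regions more than crossings, as there are twice as many edges as crossings. In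
particular there is at least one crossing. -/
structure KnotDiagram (C : Type) [Fintype C] extends GaussCode C where
  connected : ∀ p q : C × Bool, ∃ m : ℕ, next^[m] p = q
  planar : Nat.card toGaussCode.Region = Fintype.card C + 2

namespace KnotDiagram

open LaurentPolynomial

variable {C : Type} [Fintype C]

/-! ### Laurent polynomials in one variable -/

/-- The Laurent polynomial `f(x ^ m)`. -/
noncomputable def substPow (m : ℤ) (f : ℤ[T;T⁻¹]) : ℤ[T;T⁻¹] :=
  AddMonoidAlgebra.mapDomain (fun n => m * n) f

/-- The value `f(1)`. -/
noncomputable def evalOne (f : ℤ[T;T⁻¹]) : ℤ := eval₂ (RingHom.id ℤ) 1 f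

/-- The formal derivative `f'`. -/
noncomputable def derivative (f : ℤ[T;T⁻¹]) : ℤ[T;T⁻¹] :=
  f.coeff.sum fun n a => (n * a) • (T (n - 1) : ℤ[T;T⁻¹])

/-! ### The Jones polynomial -/

/-- The writhe of a diagram. -/
def writhe (D : KnotDiagram C) : ℤ := ∑ c, (D.sign c : ℤ)

/-- A state `σ` chooses the `A`-smoothing (`true`) or the `B`-smoothing (`false`) at every crossing.
Two edges are joined if one of these smoothings makes them continue each other.  The `A`-smoothing
of a positive crossing and the `B`-smoothing of a negative one respect the orientation: they join
the incoming over-edge to the outgoing under-edge and the incoming under-edge to the outgoing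
over-edge.  The two other smoothings join the incoming edges to each other and the outgoing edges
to each other. -/
inductive Joined (D : KnotDiagram C) (σ : C → Bool) : C × Bool → C × Bool → Prop
  | oriented (c : C) (b : Bool) (h : σ c = true ↔ D.sign c = 1) :
      Joined D σ (c, b) (D.next (c, !b))
  | incoming (c : C) (h : ¬ (σ c = true ↔ D.sign c = 1)) :
      Joined D σ (c, true) (c, false)
  | outgoing (c : C) (h : ¬ (σ c = true ↔ D.sign c = 1)) :
      Joined D σ (D.next (c, true)) (D.next (c, false))

/-- The number of circles that a diagram becomes when all its crossings are smoothed. -/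
noncomputable def circles (D : KnotDiagram C) (σ : C → Bool) : ℕ := Nat.card (Quot (D.Joined σ))

/-- The Kauffman bracket in the variable `A`, with value `1` on a single circle:
the sum over all states of `A ^ (#A - #B) * (-A ^ 2 - A ^ (-2)) ^ (circles - 1)`. -/
noncomputable def bracket [DecidableEq C] (D : KnotDiagram C) : ℤ[T;T⁻¹] :=
  ∑ σ : C → Bool,
    T (∑ c, if σ c = true then 1 else -1) * (-T 2 - T (-2)) ^ (D.circles σ - 1)

/-- `V` is the Jones polynomial: `V(A ^ (-4)) = (-A ^ 3) ^ (-w) * ⟨D⟩(A)` with the writhe `w`. -/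
def IsJonesPolynomial [DecidableEq C] (D : KnotDiagram C) (V : ℤ[T;T⁻¹]) : Prop :=
  substPow (-4) V = (D.writhe.negOnePow : ℤ) • (T (-3 * D.writhe) * D.bracket)

theorem IsJonesPolynomial.unique [DecidableEq C] {D : KnotDiagram C} {V V' : ℤ[T;T⁻¹]}
    (h : D.IsJonesPolynomial V) (h' : D.IsJonesPolynomial V') : V = V' := by
  refine AddMonoidAlgebra.mapDomain_injective (f := fun n : ℤ => -4 * n) ?_ (h.trans h'.symm)
  intro a b hab
  simpa using hab

/-- The Jones polynomial `V(t)`. -/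
noncomputable def jonesPolynomial [DecidableEq C] (D : KnotDiagram C) : ℤ[T;T⁻¹] :=
  Classical.epsilon D.IsJonesPolynomial

/-- The invariant `v₃ = - V'''(1) / 36 - V''(1) / 12`. -/
noncomputable def v₃ [DecidableEq C] (D : KnotDiagram C) : ℚ :=
  -(1 / 36) * evalOne (derivative^[3] D.jonesPolynomial)
    - (1 / 12) * evalOne (derivative^[2] D.jonesPolynomial)

/-! ### The Alexander and Conway polynomials -/

/-- The Alexander matrix of the Wirtinger presentation, with one generator for every edge and one
relation for every passage.  Along an over-passage the generator does not change.  Along an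
under-passage, the outgoing edge is `t * incoming + (1 - t) * over` at a positive crossing,
and the incoming edge is `t * outgoing + (1 - t) * over` at a negative one. -/
noncomputable def alexanderMatrix [DecidableEq C] (D : KnotDiagram C) :
    Matrix (C × Bool) (C × Bool) ℤ[T;T⁻¹] := Matrix.of fun p =>
  if p.2 = true then Pi.single (D.next p) 1 - Pi.single p 1
  else if D.sign p.1 = 1 then
    Pi.single (D.next p) 1 - Pi.single p (T 1) - Pi.single (p.1, true) (1 - T 1)
  else
    Pi.single p 1 - Pi.single (D.next p) (T 1) - Pi.single (p.1, true) (1 - T 1)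

/-- The Alexander ideal (first elementary ideal): it is generated by the minors of the Alexander
matrix with one row and one column deleted, which are up to sign the entries of its adjugate. -/
noncomputable def alexanderIdeal [DecidableEq C] (D : KnotDiagram C) : Ideal ℤ[T;T⁻¹] :=
  Ideal.span (Set.range fun pq : (C × Bool) × (C × Bool) => D.alexanderMatrix.adjugate pq.1 pq.2)

/-- `Δ` is the Alexander polynomial in Conway's normalization: it generates the Alexander ideal,
`Δ(t⁻¹) = Δ(t)` and `Δ(1) = 1`. -/
def IsAlexanderPolynomial [DecidableEq C] (D : KnotDiagram C) (Δ : ℤ[T;T⁻¹]) : Prop :=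
  D.alexanderIdeal = Ideal.span {Δ} ∧ invert Δ = Δ ∧ evalOne Δ = 1

/-- `P` is the Conway polynomial: `P(s - s⁻¹) = Δ(s ^ 2)`, that is, `P(z) = Δ(t)` for
`z = t ^ (1/2) - t ^ (-1/2)`. -/
def IsConwayPolynomial [DecidableEq C] (D : KnotDiagram C) (P : Polynomial ℤ) : Prop :=
  ∃ Δ, D.IsAlexanderPolynomial Δ ∧
    Polynomial.aeval (T 1 - T (-1) : ℤ[T;T⁻¹]) P = substPow 2 Δ

theorem eq_T_of_isUnit {u : ℤ[T;T⁻¹]} (hu : IsUnit u) (h1 : evalOne u = 1) : ∃ n : ℤ, u = T n := by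
  obtain ⟨v, huv⟩ := hu.exists_right_inv
  obtain ⟨n, p, hp⟩ := exists_T_pow u
  obtain ⟨m, q, hq⟩ := exists_T_pow v
  have hpq : p * q = Polynomial.X ^ (n + m) := by
    apply Polynomial.toLaurent_injective
    rw [map_mul, hp, hq, Polynomial.toLaurent_X_pow, Nat.cast_add, T_add]
    calc u * T n * (v * T m) = (u * v) * (T n * T m) := by ring
      _ = _ := by rw [huv, one_mul]
  obtain ⟨i, -, hi⟩ := (dvd_prime_pow Polynomial.prime_X _).1 (Dvd.intro _ hpq)
  obtain ⟨w, hw⟩ := hi.symm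
  obtain ⟨a, -, ha⟩ := Polynomial.isUnit_iff.1 w.isUnit
  have hu' : u = T (-n) * (T i * LaurentPolynomial.C a) := by
    have : Polynomial.toLaurent p = T i * LaurentPolynomial.C a := by
      rw [← hw, ← ha, map_mul, Polynomial.toLaurent_X_pow, Polynomial.toLaurent_C]
    rw [← this, hp, mul_comm, mul_T_assoc]
    simp
  have ha1 : a = 1 := by
    rw [hu'] at h1
    simpa [evalOne, eval₂_T, eval₂_C] using h1
  exact ⟨-n + i, by rw [hu', ha1, T_add, map_one, mul_one]⟩

theorem IsAlexanderPolynomial.unique [DecidableEq C] {D : KnotDiagram C} {Δ Δ' : ℤ[T;T⁻¹]}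
    (h : D.IsAlexanderPolynomial Δ) (h' : D.IsAlexanderPolynomial Δ') : Δ = Δ' := by
  have hΔ : Δ ≠ 0 := by
    rintro rfl
    simpa [evalOne] using h.2.2
  obtain ⟨u, hu⟩ := Ideal.span_singleton_eq_span_singleton.1 (h.1.symm.trans h'.1)
  have h1 : evalOne (u : ℤ[T;T⁻¹]) = 1 := by
    have := h'.2.2
    rw [← hu, evalOne, map_mul] at this
    have h2 := h.2.2
    rw [evalOne] at h2
    rwa [h2, one_mul] at this
  obtain ⟨n, hn⟩ := eq_T_of_isUnit u.isUnit h1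
  have hinv : invert (u : ℤ[T;T⁻¹]) = u := by
    have := h'.2.1
    rw [← hu, map_mul, h.2.1] at this
    exact mul_left_cancel₀ hΔ this
  rw [hn, invert_T] at hinv
  have hn0 : n = 0 := by
    have := congrArg (fun f : ℤ[T;T⁻¹] => f.coeff n) hinv
    have hc : ∀ k : ℤ, (T k : ℤ[T;T⁻¹]).coeff n = if k = n then 1 else 0 := fun k => by
      rw [T, AddMonoidAlgebra.coeff_single, Finsupp.single_apply]
    by_contra hn0
    simp only [hc] at this
    rw [if_neg (by omega), if_pos trivial] at this
    exact zero_ne_one this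
  rw [← hu, hn, hn0, T_zero, mul_one]

theorem IsConwayPolynomial.unique [DecidableEq C] {D : KnotDiagram C} {P P' : Polynomial ℤ}
    (h : D.IsConwayPolynomial P) (h' : D.IsConwayPolynomial P') : P = P' := by
  obtain ⟨Δ, hΔ, hP⟩ := h
  obtain ⟨Δ', hΔ', hP'⟩ := h'
  obtain rfl := hΔ.unique hΔ'
  have key : Polynomial.aeval (T 1 - T (-1) : ℤ[T;T⁻¹]) (P - P') = 0 := by
    rw [map_sub, hP, hP', sub_self]
  by_contra hne
  have hne' : (P - P').map (Int.castRingHom ℚ) ≠ 0 := by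
    rw [Ne, Polynomial.map_eq_zero_iff (RingHom.injective_int _)]
    exact sub_ne_zero.2 hne
  refine Polynomial.eq_zero_of_infinite_isRoot _ ?_ |> hne'
  have hroot : ∀ n : ℕ, ((n : ℚ) + 1 - ((n : ℚ) + 1)⁻¹) ∈
      {x | ((P - P').map (Int.castRingHom ℚ)).IsRoot x} := by
    intro n
    have hn : (n : ℚ) + 1 ≠ 0 := by positivity
    have := congrArg (eval₂ (Int.castRingHom ℚ) (Units.mk0 ((n : ℚ) + 1) hn)) key
    rw [map_zero, Polynomial.aeval_def, Polynomial.hom_eval₂, map_sub, eval₂_T, eval₂_T] at this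
    rw [Set.mem_ofPred_eq, Polynomial.IsRoot, Polynomial.eval_map]
    have hf : (eval₂ (Int.castRingHom ℚ) (Units.mk0 ((n : ℚ) + 1) hn)).comp
        (algebraMap ℤ ℤ[T;T⁻¹]) = Int.castRingHom ℚ := RingHom.ext_int _ _
    rw [hf] at this
    simpa using this
  refine Set.infinite_of_injective_forall_mem (f := fun n : ℕ => (n : ℚ) + 1 - ((n : ℚ) + 1)⁻¹)
    ?_ hroot
  refine StrictMono.injective fun a b hab => ?_
  have h1 : (a : ℚ) + 1 < b + 1 := by exact_mod_cast Nat.succ_lt_succ hab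
  have h2 : ((b : ℚ) + 1)⁻¹ < ((a : ℚ) + 1)⁻¹ := by gcongr
  linarith

/-- The Conway polynomial `∇(z)`. -/
noncomputable def conwayPolynomial [DecidableEq C] (D : KnotDiagram C) : Polynomial ℤ :=
  Classical.epsilon D.IsConwayPolynomial

/-- The coefficient of `z ^ 2` in the Conway polynomial. -/
noncomputable def a₂ [DecidableEq C] (D : KnotDiagram C) : ℤ := D.conwayPolynomial.coeff 2

end KnotDiagram

/-! ### Odd pretzel knots -/

/-- The crossings of the pretzel diagram `P(2k₁+1, …, 2k_m+1)`: the column `i` consists of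
`|2kᵢ + 1|` half twists, numbered `0, 1, 2, …` from top to bottom. -/
abbrev PretzelCrossing {m : ℕ} (k : Fin m → ℤ) : Type := (i : Fin m) × Fin (2 * k i + 1).natAbs

namespace PretzelCrossing

variable {m : ℕ} (k : Fin m → ℤ)

/-- The number of half twists is odd, so there is a first one. -/
def top (i : Fin m) : PretzelCrossing k := ⟨i, ⟨0, by omega⟩⟩

/-- The last half twist of a column. -/
def bottom (i : Fin m) : PretzelCrossing k :=
  ⟨i, ⟨(2 * k i + 1).natAbs - 1, by omega⟩⟩

/-- The strand on which the knot runs downwards (`d = true`) or upwards (`d = false`) through the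
crossing `c`.  In every column one strand runs down from the upper left to the lower right end,
and the other one up from the lower left to the upper right end.  So the
strand of slope `/` is the descending one exactly at the crossings of odd number.  The over-strand
is the one of slope `/` if `0 ≤ kᵢ` (right-handed twists) and the one of slope `\` otherwise. -/
def passage (c : PretzelCrossing k) (d : Bool) : PretzelCrossing k × Bool :=
  (c, (d == decide (Odd c.2.val)) == decide (0 ≤ k c.1))

/-- Whether the knot runs downwards on the given strand. -/
def descends (p : PretzelCrossing k × Bool) : Bool :=
  (p.2 == decide (0 ≤ k p.1.1)) == decide (Odd p.1.2.val)

variable [NeZero m]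

/-- The passage after the downward (`true`) or upward (`false`) passage of a crossing.  Inside a
column the knot goes on to the adjacent half twist; the upper (lower) right end of
each column is joined to the upper (lower) left end of the next column, cyclically. -/
def follow : PretzelCrossing k → Bool → PretzelCrossing k × Bool
  | ⟨i, j⟩, true =>
    if h : j.val + 1 < (2 * k i + 1).natAbs then passage k ⟨i, ⟨j.val + 1, h⟩⟩ true
    else passage k (bottom k (i + 1)) false
  | ⟨i, j⟩, false =>
    if 0 < j.val then passage k ⟨i, ⟨j.val - 1, by omega⟩⟩ false
    else passage k (top k (i + 1)) true

end PretzelCrossing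

/-- The signed Gauss code of the standard diagram of the pretzel knot `P(2k₁+1, …, 2k_m+1)` with an
odd number `m` of columns.  As the two strands of a column run in opposite directions,
right-handed twists have negative crossings. -/
def pretzelCode {m : ℕ} [NeZero m] (k : Fin m → ℤ) : GaussCode (PretzelCrossing k) where
  sign c := if 0 ≤ k c.1 then -1 else 1
  next p := PretzelCrossing.follow k p.1 (PretzelCrossing.descends k p)

namespace PretzelCrossing

variable {m : ℕ} (k : Fin m → ℤ)

theorem passage_descends (p : PretzelCrossing k × Bool) : passage k p.1 (descends k p) = p := by
  obtain ⟨c, b⟩ := p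
  simp only [passage, descends, Prod.mk.injEq, true_and]
  cases b <;> cases decide (0 ≤ k c.1) <;> cases decide (Odd c.2.val) <;> rfl

theorem even_bottom (i : Fin m) : Even ((2 * k i + 1).natAbs - 1) := by
  have : Odd (2 * k i + 1).natAbs := Int.natAbs_odd.2 ⟨k i, rfl⟩
  exact Nat.Odd.sub_odd this odd_one

theorem descends_passage (c : PretzelCrossing k) (d : Bool) : descends k (passage k c d) = d := by
  have key : ∀ d x y : Bool, ((((d == y) == x) == x) == y) = d := by decide
  exact key _ _ _

variable [NeZero m]

theorem next_passage (c : PretzelCrossing k) (d : Bool) :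
    (pretzelCode k).next (passage k c d) = follow k c d := by
  change follow k c (descends k (passage k c d)) = _
  rw [descends_passage]

theorem next_down (i : Fin m) (j : ℕ) (h : j + 1 < (2 * k i + 1).natAbs) :
    (pretzelCode k).next (passage k ⟨i, ⟨j, by omega⟩⟩ true) =
      passage k ⟨i, ⟨j + 1, h⟩⟩ true := by
  rw [next_passage, follow, dif_pos h]

theorem next_down_bottom (i : Fin m) :
    (pretzelCode k).next (passage k (bottom k i) true) =
      passage k (bottom k (i + 1)) false := by
  rw [next_passage, bottom, follow, dif_neg (by dsimp only; omega)]

theorem next_up (i : Fin m) (j : ℕ) (h : j + 1 < (2 * k i + 1).natAbs) :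
    (pretzelCode k).next (passage k ⟨i, ⟨j + 1, h⟩⟩ false) =
      passage k ⟨i, ⟨j, by omega⟩⟩ false := by
  rw [next_passage, follow, if_pos (Nat.succ_pos j)]
  rfl

theorem next_up_top (i : Fin m) :
    (pretzelCode k).next (passage k (top k i) false) =
      passage k (top k (i + 1)) true := by
  rw [next_passage, top, follow, if_neg (Nat.lt_irrefl 0)]

theorem first_eq (c : PretzelCrossing k) :
    (pretzelCode k).first c = passage k c (decide (Even c.2.val)) := by
  simp only [GaussCode.first, passage, pretzelCode, Prod.mk.injEq, true_and, ← Nat.not_odd_iff_even]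
  by_cases h : 0 ≤ k c.1 <;> by_cases h' : Odd c.2.val <;> simp [h, h']

theorem second_eq (c : PretzelCrossing k) :
    (pretzelCode k).second c = passage k c (decide (Odd c.2.val)) := by
  simp only [GaussCode.second, passage, pretzelCode, Prod.mk.injEq, true_and]
  by_cases h : 0 ≤ k c.1 <;> by_cases h' : Odd c.2.val <;> simp [h, h']

/-! ### The pretzel diagram has one component -/

/-- The knot runs from the passage `p` to the passage `q`. -/
def Runs (p q : PretzelCrossing k × Bool) : Prop := ∃ r : ℕ, (pretzelCode k).next^[r] p = q

variable {k}

theorem Runs.step {p q : PretzelCrossing k × Bool} (h : (pretzelCode k).next p = q) : Runs k p q :=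
  ⟨1, h⟩

theorem Runs.trans {p q r : PretzelCrossing k × Bool} (h : Runs k p q) (h' : Runs k q r) :
    Runs k p r := by
  obtain ⟨a, rfl⟩ := h
  obtain ⟨b, rfl⟩ := h'
  exact ⟨b + a, Function.iterate_add_apply _ _ _ _⟩

theorem runs_down (i : Fin m) (j j' : ℕ) (hj : j ≤ j') (h' : j' < (2 * k i + 1).natAbs) :
    Runs k (passage k ⟨i, ⟨j, by omega⟩⟩ true) (passage k ⟨i, ⟨j', h'⟩⟩ true) := by
  induction j', hj using Nat.le_induction with
  | base => exact ⟨0, rfl⟩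
  | succ l hl ih => exact (ih (by omega)).trans (.step (next_down k i l h'))

theorem runs_up (i : Fin m) (j j' : ℕ) (hj : j ≤ j') (h' : j' < (2 * k i + 1).natAbs) :
    Runs k (passage k ⟨i, ⟨j', h'⟩⟩ false) (passage k ⟨i, ⟨j, by omega⟩⟩ false) := by
  induction j', hj using Nat.le_induction with
  | base => exact ⟨0, rfl⟩
  | succ l hl ih => exact (Runs.step (next_up k i l h')).trans (ih (by omega))

theorem runs_two_columns (i : Fin m) :
    Runs k (passage k (top k i) true) (passage k (top k (i + 1 + 1)) true) :=
  ((runs_down i 0 _ (Nat.zero_le _) (bottom k i).2.2).trans (.step (next_down_bottom k i))).trans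
    ((runs_up (i + 1) 0 _ (Nat.zero_le _) (bottom k (i + 1)).2.2).trans
      (.step (next_up_top k (i + 1))))

open Function Fin.CommRing in
theorem pretzel_connected {g : ℕ} (k : Fin (2 * g + 1) → ℤ) (p q : PretzelCrossing k × Bool) :
    Runs k p q := by
  have h2 : ∀ (i : Fin (2 * g + 1)) (r : ℕ),
      Runs k (passage k (top k i) true) (passage k (top k ((fun x => x + 1 + 1)^[r] i)) true) := by
    intro i r
    induction r with
    | zero => exact ⟨0, rfl⟩
    | succ r ih =>
      rw [iterate_succ_apply']
      exact ih.trans (runs_two_columns _)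
  have hit : ∀ (i : Fin (2 * g + 1)) (r : ℕ),
      (fun x : Fin (2 * g + 1) => x + 1 + 1)^[r] i = i + ((2 * r : ℕ) : Fin (2 * g + 1)) := by
    intro i r
    induction r with
    | zero => simp
    | succ r ih =>
      rw [iterate_succ_apply', ih, mul_add, Nat.cast_add]
      simp only [mul_one, Nat.cast_ofNat, add_assoc]
      norm_num
  have htop : ∀ i i' : Fin (2 * g + 1),
      Runs k (passage k (top k i) true) (passage k (top k i') true) := by
    intro i i'
    have := h2 i ((i' - i).val * (g + 1))
    rw [hit] at this
    have e : ((2 * ((i' - i).val * (g + 1)) : ℕ) : Fin (2 * g + 1)) = i' - i := by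
      rw [show 2 * ((i' - i).val * (g + 1)) = (i' - i).val + (2 * g + 1) * (i' - i).val by ring,
        Nat.cast_add, Nat.cast_mul, Fin.natCast_self, zero_mul, add_zero, Fin.cast_val_eq_self]
    rwa [e, add_sub_cancel] at this
  have hto : ∃ i, Runs k p (passage k (top k i) true) := by
    rw [← passage_descends k p]
    obtain ⟨⟨i, j, hj⟩, b⟩ := p
    cases descends k (⟨i, j, hj⟩, b)
    · exact ⟨_, (runs_up i 0 j (Nat.zero_le _) hj).trans (.step (next_up_top k i))⟩
    · exact ⟨_, ((runs_down i j _ (by simp only [bottom]; omega) (bottom k i).2.2).trans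
        (.step (next_down_bottom k i))).trans ((runs_up (i + 1) 0 _ (Nat.zero_le _)
          (bottom k (i + 1)).2.2).trans (.step (next_up_top k (i + 1))))⟩
  have hfrom : ∃ i, Runs k (passage k (top k i) true) q := by
    rw [← passage_descends k q]
    obtain ⟨⟨i, j, hj⟩, b⟩ := q
    cases descends k (⟨i, j, hj⟩, b)
    · refine ⟨i - 1, ((runs_down (i - 1) 0 _ (Nat.zero_le _) (bottom k (i - 1)).2.2).trans
        (.step (next_down_bottom k (i - 1)))).trans ?_⟩
      rw [sub_add_cancel]
      exact runs_up i j _ (by simp only [bottom]; omega) (bottom k i).2.2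
    · exact ⟨i, runs_down i 0 j (Nat.zero_le _) hj⟩
  obtain ⟨i, hi⟩ := hto
  obtain ⟨i', hi'⟩ := hfrom
  exact (hi.trans (htop i i')).trans hi'

/-! ### The pretzel diagram is planar -/

variable (k) in
/-- The names of the regions: a region between each column and the next one, the region above and
the region below all the columns, and the bigons inside the columns. -/
abbrev RegionName : Type := Fin m ⊕ Bool ⊕ ((i : Fin m) × Fin ((2 * k i + 1).natAbs - 1))

/-- The region on a side (`true` for the left-hand one) of the edge that enters a crossing
downwards (`true`) or upwards (`false`). -/
def regionName : PretzelCrossing k → Bool → Bool → RegionName k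
  | ⟨i, j⟩, true, s =>
    if s = decide (Even j.val) then
      if h : 0 < j.val then .inr (.inr ⟨i, ⟨j.val - 1, by omega⟩⟩) else .inr (.inl true)
    else .inl (if Even j.val then i - 1 else i)
  | ⟨i, j⟩, false, s =>
    if s = decide (Odd j.val) then
      if h : j.val + 1 < (2 * k i + 1).natAbs then .inr (.inr ⟨i, ⟨j.val, by omega⟩⟩)
      else .inr (.inl false)
    else .inl (if Even j.val then i - 1 else i)

variable (k) in
/-- The region on a side of an edge. -/
def sideName (x : (PretzelCrossing k × Bool) × Bool) : RegionName k :=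
  regionName x.1.1 (descends k x.1) x.2

theorem sideName_passage (c : PretzelCrossing k) (d s : Bool) :
    sideName k (passage k c d, s) = regionName c d s := by
  rw [sideName, descends_passage]
  rfl

/-- The left-hand (`true`) or right-hand side of the edge that enters a crossing. -/
abbrev side (c : PretzelCrossing k) (d s : Bool) : (pretzelCode k).Region :=
  Quot.mk _ (passage k c d, s)

open Fin.CommRing in
theorem sideName_adj (x y) (h : (pretzelCode k).SideAdj x y) : sideName k x = sideName k y := by
  rcases h with c | c | c | c <;> obtain ⟨i, ⟨j, hj⟩⟩ := c <;>
    rw [first_eq, second_eq] <;> rcases Nat.even_or_odd j with he | ho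
  all_goals
    first
    | have ho : ¬ Odd j := Nat.not_odd_iff_even.2 he
      have ho' : Odd (j + 1) := he.add_one
      have he' : ¬ Even (j + 1) := Nat.not_even_iff_odd.2 ho'
    | have he : ¬ Even j := Nat.not_even_iff_odd.2 ho
      have he' : Even (j + 1) := ho.add_one
      have ho' : ¬ Odd (j + 1) := Nat.not_odd_iff_even.2 he'
    have hb := even_bottom k (i + 1)
    have hb' := Nat.not_odd_iff_even.2 hb
    have hn := even_bottom k i
    have hp : 0 < j → (Odd (j - 1) ↔ Even j) := by
      intro h
      obtain ⟨l, rfl⟩ := Nat.exists_eq_succ_of_ne_zero h.ne'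
      simp [Nat.even_add_one]
    have hp' : 0 < j → (Even (j - 1) ↔ Odd j) := by
      intro h
      obtain ⟨l, rfl⟩ := Nat.exists_eq_succ_of_ne_zero h.ne'
      simp [Nat.odd_add_one]
    have hJ : ¬ Even j → 0 < j ∧ j + 1 < (2 * k i + 1).natAbs := by
      intro h
      obtain ⟨a, ha⟩ := Nat.not_even_iff_odd.1 h
      obtain ⟨b, hb⟩ := hn
      omega
    have hN : ¬ (2 * k (i + 1) + 1).natAbs - 1 + 1 < (2 * k (i + 1) + 1).natAbs := by omega
    have hj1 : 0 < j → j - 1 + 1 < (2 * k i + 1).natAbs := by omega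
    simp only [he, ho, decide_true, decide_false, next_passage, follow]
    try split_ifs
    all_goals first
      | (exfalso; have := hJ he; omega)
      | simp [sideName_passage, regionName, top, bottom, *]

/-- The region with a given name. -/
def namedRegion : RegionName k → (pretzelCode k).Region
  | .inl i => side (top k (i + 1)) true false
  | .inr (.inl true) => side (top k 0) true true
  | .inr (.inl false) => side (bottom k 0) false false
  | .inr (.inr ⟨i, l⟩) => side ⟨i, ⟨l.val, by omega⟩⟩ false (decide (Odd l.val))

theorem side_even (c : PretzelCrossing k) (h : Even c.2.val) :
    (Quot.mk _ (follow k c true, true) : (pretzelCode k).Region)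
        = Quot.mk _ (follow k c false, false) ∧
      Quot.mk _ (follow k c false, true) = side c true true ∧
      side c true false = side c false true ∧
      side c false false = Quot.mk _ (follow k c true, false) := by
  have h1 : (pretzelCode k).first c = passage k c true := by rw [first_eq, decide_eq_true h]
  have h2 : (pretzelCode k).second c = passage k c false := by
    rw [second_eq, decide_eq_false (Nat.not_odd_iff_even.2 h)]
  refine ⟨?_, ?_, ?_, ?_⟩
  · have A := GaussCode.SideAdj.ahead (D := pretzelCode k) c
    simp only [h1, h2, next_passage] at A
    exact Quot.sound A
  · have A := GaussCode.SideAdj.left (D := pretzelCode k) c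
    simp only [h1, h2, next_passage] at A
    exact Quot.sound A
  · have A := GaussCode.SideAdj.behind (D := pretzelCode k) c
    simp only [h1, h2] at A
    exact Quot.sound A
  · have A := GaussCode.SideAdj.right (D := pretzelCode k) c
    simp only [h1, h2, next_passage] at A
    exact Quot.sound A

theorem side_odd (c : PretzelCrossing k) (h : Odd c.2.val) :
    (Quot.mk _ (follow k c false, true) : (pretzelCode k).Region)
        = Quot.mk _ (follow k c true, false) ∧
      Quot.mk _ (follow k c true, true) = side c false true ∧
      side c false false = side c true true ∧
      side c true false = Quot.mk _ (follow k c false, false) := by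
  have h1 : (pretzelCode k).first c = passage k c false := by
    rw [first_eq, decide_eq_false (Nat.not_even_iff_odd.2 h)]
  have h2 : (pretzelCode k).second c = passage k c true := by rw [second_eq, decide_eq_true h]
  refine ⟨?_, ?_, ?_, ?_⟩
  · have A := GaussCode.SideAdj.ahead (D := pretzelCode k) c
    simp only [h1, h2, next_passage] at A
    exact Quot.sound A
  · have A := GaussCode.SideAdj.left (D := pretzelCode k) c
    simp only [h1, h2, next_passage] at A
    exact Quot.sound A
  · have A := GaussCode.SideAdj.behind (D := pretzelCode k) c
    simp only [h1, h2] at A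
    exact Quot.sound A
  · have A := GaussCode.SideAdj.right (D := pretzelCode k) c
    simp only [h1, h2, next_passage] at A
    exact Quot.sound A

theorem follow_down (i : Fin m) (j : ℕ) (h : j + 1 < (2 * k i + 1).natAbs) :
    follow k ⟨i, ⟨j, by omega⟩⟩ true = passage k ⟨i, ⟨j + 1, h⟩⟩ true := by
  rw [← next_passage, next_down]

theorem follow_up (i : Fin m) (j : ℕ) (h : j + 1 < (2 * k i + 1).natAbs) :
    follow k ⟨i, ⟨j + 1, h⟩⟩ false = passage k ⟨i, ⟨j, by omega⟩⟩ false := by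
  rw [← next_passage, next_up]

/-- The sides in a column that face the previous column. -/
theorem side_west (i : Fin m) (a : ℕ) (h : 2 * a < (2 * k i + 1).natAbs) :
    side (k := k) ⟨i, ⟨2 * a, h⟩⟩ true false = side (top k i) true false ∧
      side (k := k) ⟨i, ⟨2 * a, h⟩⟩ false true = side (top k i) true false := by
  have hb : side (k := k) ⟨i, ⟨2 * a, h⟩⟩ true false = side (top k i) true false := by
    induction a with
    | zero => rfl
    | succ a ih =>
      have ih := ih (by omega)
      have h0 := (side_even (k := k) ⟨i, ⟨2 * a, by omega⟩⟩ (even_two_mul a)).2.2.1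
      have h1 := (side_odd (k := k) ⟨i, ⟨2 * a + 1, by omega⟩⟩ ⟨a, rfl⟩).1
      rw [follow_up i (2 * a) (by omega), follow_down i (2 * a + 1) h] at h1
      exact (h0.trans h1).symm.trans ih
  exact ⟨hb, (side_even (k := k) ⟨i, ⟨2 * a, h⟩⟩ (even_two_mul a)).2.2.1.symm.trans hb⟩

/-- The sides in a column that face the next column. -/
theorem side_east (i : Fin m) (a : ℕ) (h : 2 * a + 1 < (2 * k i + 1).natAbs) :
    side (k := k) ⟨i, ⟨2 * a + 1, h⟩⟩ true true = side (top k (i + 1)) true false ∧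
      side (k := k) ⟨i, ⟨2 * a + 1, h⟩⟩ false false = side (top k (i + 1)) true false := by
  have hb : side (k := k) ⟨i, ⟨2 * a + 1, h⟩⟩ true true = side (top k (i + 1)) true false := by
    induction a with
    | zero =>
      have h0 := (side_even (top k i) (Nat.even_iff.2 rfl)).1
      rw [top, follow_down i 0 (by omega)] at h0
      refine h0.trans ?_
      change Quot.mk _ (follow k (top k i) false, false) = _
      rw [← next_passage, next_up_top]
    | succ a ih =>
      have ih := ih (by omega)
      have h0 := (side_odd (k := k) ⟨i, ⟨2 * a + 1, by omega⟩⟩ ⟨a, rfl⟩).2.2.1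
      have h1 := (side_even (k := k) ⟨i, ⟨2 * a + 1 + 1, by omega⟩⟩ (even_two_mul (a + 1))).1
      rw [follow_up i (2 * a + 1) (by omega), follow_down i (2 * a + 1 + 1) h] at h1
      exact (h1.trans h0).trans ih
  exact ⟨hb, (side_odd (k := k) ⟨i, ⟨2 * a + 1, h⟩⟩ ⟨a, rfl⟩).2.2.1.trans hb⟩

open Fin.CommRing in
theorem column_induction {p : Fin m → Prop} (h0 : p 0) (h : ∀ i, p i → p (i + 1)) (i : Fin m) :
    p i := by
  have : ∀ r : ℕ, p (r : Fin m) := by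
    intro r
    induction r with
    | zero => simpa using h0
    | succ r ih => simpa using h _ ih
  simpa using this i.val

theorem side_top (i : Fin m) :
    side (k := k) (top k i) true true = side (top k 0) true true := by
  induction i using column_induction with
  | h0 => rfl
  | h i ih =>
    rw [← ih, ← (side_even (top k i) (Nat.even_iff.2 rfl)).2.1, ← next_passage, next_up_top]

theorem side_bottom (i : Fin m) :
    side (k := k) (bottom k i) false false = side (bottom k 0) false false := by
  induction i using column_induction with
  | h0 => rfl
  | h i ih =>
    rw [← ih, (side_even (bottom k i) (even_bottom k i)).2.2.2, ← next_passage, next_down_bottom]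

open Fin.CommRing in
theorem namedRegion_regionName (c : PretzelCrossing k) (d s : Bool) :
    namedRegion (regionName c d s) = side c d s := by
  obtain ⟨i, ⟨j, hj⟩⟩ := c
  obtain ⟨n, hn⟩ : Odd (2 * k i + 1).natAbs := Int.natAbs_odd.2 ⟨k i, rfl⟩
  obtain ⟨a, rfl | rfl⟩ := Nat.even_or_odd' j
  · have he : Even (2 * a) := even_two_mul a
    have ho : ¬ Odd (2 * a) := Nat.not_odd_iff_even.2 he
    cases d <;> cases s <;>
      simp only [regionName, he, ho, decide_true, decide_false, if_true, if_false,
        Bool.false_eq_true, Bool.true_eq_false]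
    · split_ifs with h
      · simp only [namedRegion, ho, decide_false]
      · have : (⟨i, ⟨2 * a, hj⟩⟩ : PretzelCrossing k) = bottom k i := by
          simp only [bottom, Sigma.mk.injEq, heq_eq_eq, true_and, Fin.mk.injEq]
          omega
        rw [this]
        exact (side_bottom i).symm
    · rw [(side_west i a hj).2]
      simp only [namedRegion, sub_add_cancel]
    · rw [(side_west i a hj).1]
      simp only [namedRegion, sub_add_cancel]
    · split_ifs with h
      · obtain ⟨b, rfl⟩ : ∃ b, a = b + 1 := ⟨a - 1, by omega⟩
        have h0 := (side_odd (k := k) ⟨i, ⟨2 * b + 1, by omega⟩⟩ ⟨b, rfl⟩).2.1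
        rw [follow_down i (2 * b + 1) hj] at h0
        have hob : Odd (2 * (b + 1) - 1) := ⟨b, by omega⟩
        simp only [namedRegion, hob, decide_true]
        exact h0.symm
      · obtain rfl : a = 0 := by omega
        exact (side_top i).symm
  · have ho : Odd (2 * a + 1) := ⟨a, rfl⟩
    have he : ¬ Even (2 * a + 1) := Nat.not_even_iff_odd.2 ho
    cases d <;> cases s <;>
      simp only [regionName, he, ho, decide_true, decide_false, if_true, if_false,
        Bool.false_eq_true, Bool.true_eq_false]
    · rw [(side_east i a hj).2]
      rfl
    · rw [dif_pos (by omega)]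
      simp only [namedRegion, ho, decide_true]
    · rw [dif_pos (by omega)]
      have h0 := (side_even (k := k) ⟨i, ⟨2 * a, by omega⟩⟩ (even_two_mul a)).2.2.2
      rw [follow_down i (2 * a) hj] at h0
      have hoa : ¬ Odd (2 * a + 1 - 1) := by simp
      simp only [namedRegion, hoa, decide_false]
      exact h0
    · rw [(side_east i a hj).1]
      rfl

open Fin.CommRing in
theorem sideName_namedRegion (x : RegionName k) :
    Quot.lift (sideName k) sideName_adj (namedRegion x) = x := by
  rcases x with i | b | ⟨i, ⟨l, hl⟩⟩
  · change sideName k (passage k (top k (i + 1)) true, false) = _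
    rw [sideName_passage]
    simp [regionName, top]
  · cases b
    · change sideName k (passage k (bottom k 0) false, false) = _
      rw [sideName_passage]
      rw [bottom, regionName, if_pos (by simpa using even_bottom k 0), dif_neg (by dsimp only; omega)]
    · change sideName k (passage k (top k 0) true, true) = _
      rw [sideName_passage]
      simp [regionName, top]
  · change sideName k (passage k ⟨i, ⟨l, by omega⟩⟩ false, decide (Odd l)) = _
    rw [sideName_passage]
    simp only [regionName, if_true]
    rw [dif_pos (by omega)]

theorem pretzel_planar {m : ℕ} [NeZero m] (k : Fin m → ℤ) :
    Nat.card (pretzelCode k).Region = Fintype.card (PretzelCrossing k) + 2 := by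
  have e : (pretzelCode k).Region ≃ RegionName k :=
    { toFun := Quot.lift (sideName k) sideName_adj
      invFun := namedRegion
      left_inv := by
        rintro ⟨⟨p, s⟩⟩
        change namedRegion (sideName k (p, s)) = Quot.mk _ (p, s)
        rw [← passage_descends k p, sideName_passage, namedRegion_regionName]
      right_inv := sideName_namedRegion }
  rw [Nat.card_congr e, Nat.card_eq_fintype_card]
  simp only [Fintype.card_sum, Fintype.card_fin, Fintype.card_bool, Fintype.card_sigma]
  have : ∑ i : Fin m, (2 * k i + 1).natAbs = ∑ i : Fin m, (((2 * k i + 1).natAbs - 1) + 1) :=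
    Finset.sum_congr rfl fun i _ => by omega
  rw [this, Finset.sum_add_distrib]
  simp
  ring

end PretzelCrossing

/-- The knot `K(k₁, …, k_{2g+1})`, that is, the standard diagram of the pretzel knot
`P(2k₁+1, …, 2k_{2g+1}+1)`. -/
def pretzelKnot {g : ℕ} (k : Fin (2 * g + 1) → ℤ) : KnotDiagram (PretzelCrossing k) where
  toGaussCode := pretzelCode k
  connected := PretzelCrossing.pretzel_connected k
  planar := PretzelCrossing.pretzel_planar k

/-- The elementary symmetric polynomial `s_n(k₁, …, k_m)`. -/
def elemSymm {m : ℕ} (n : ℕ) (k : Fin m → ℤ) : ℤ :=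
  ∑ P ∈ (Finset.univ : Finset (Fin m)).powersetCard n, ∏ j ∈ P, k j

/-! Write `n_i = 2 k_i + 1` and let `m = 2g+1` be the number of columns.

Alexander side. A Fox colouring of the edges is determined by the colours `x_i` at the upper left
ends of the columns: below any number of half twists the colours in the column `i` are explicit
combinations of `x_i` and `x_{i+1}`. This elimination is triangular with units on the diagonal, so
the ideal of cofactors survives it (`cofactorIdeal_eliminate`). The relations left over sit at the
lower ends and form a product `W * D`, where `D` takes cyclic differences and `W` is cyclic
bidiagonal with entries `a_i = k_i (τ - 1) + τ` and `-b_i = -(k_i (τ - 1) - 1)`, `τ = t⁻¹`. All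
cofactors of `W * D` equal one element `c` with `(1 + τ) c = ∏ a_i - ∏ b_i`
(`exists_cofactorIdeal_cyclic`). With `z = x - y`, `x y = 1`, this says `(x + y) ∇(z) = ∏ (k_i z +
x) - ∏ (k_i z - y)`, that is, `∇ = ∑ s_n z^n F_{m-n}(z)` with Fibonacci polynomials `F_n`, and the
coefficient of `z²` can be read off.

Jones side. The two strands of a column are antiparallel. A state cuts some half twists
horizontally; `c ≥ 1` cuts in a column split off `c - 1` small circles, and the remaining circles
number `r` if `r ≥ 1` columns are uncut, and two if none is. Hence the state sum is, up to one
correction term, a product over the columns (`loopValue_mul_bracket`). In terms of `t` this becomes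
`(t + 2 + t⁻¹)^(g+1) V = ∏ (1 - (t + 1 + t⁻¹) t^(-n_i)) + (t + 1 + t⁻¹) ∏ (1 + t^(-n_i))`.
Substituting `t = exp X` turns `v₃` into a combination of the coefficients of `X` and `X³`.
Logarithms turn the products into power sums of the `n_i`, and Newton's identities express these by
`s_1, s_2, s_3` (`v₃_of_functional_equation`). -/

/-! ### Ideals of cofactors and elimination of generators -/

namespace Matrix

variable {n α β R : Type*} [Fintype n] [DecidableEq n] [Fintype α] [DecidableEq α]
  [Fintype β] [DecidableEq β] [CommRing R]

/-- The ideal generated by the cofactors of a square matrix. -/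
def cofactorIdeal (M : Matrix n n R) : Ideal R :=
  Ideal.span (Set.range fun p : n × n => M.adjugate p.1 p.2)

theorem adjugate_mem_cofactorIdeal (M : Matrix n n R) (i j : n) :
    M.adjugate i j ∈ M.cofactorIdeal :=
  Ideal.subset_span ⟨(i, j), rfl⟩

theorem cofactorIdeal_le {M : Matrix n n R} {I : Ideal R} (h : ∀ i j, M.adjugate i j ∈ I) :
    M.cofactorIdeal ≤ I :=
  Ideal.span_le.2 (by rintro _ ⟨p, rfl⟩; exact h _ _)

/-- The adjugate reverses products, so every cofactor of `M * N` is a linear combination of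
cofactors of `M`, and likewise of `N`. -/
theorem cofactorIdeal_mul_le_left (M N : Matrix n n R) :
    (M * N).cofactorIdeal ≤ M.cofactorIdeal := by
  refine cofactorIdeal_le fun i j => ?_
  rw [adjugate_mul_distrib, mul_apply]
  exact Ideal.sum_mem _ fun l _ => Ideal.mul_mem_left _ _ (adjugate_mem_cofactorIdeal M _ _)

theorem cofactorIdeal_mul_le_right (M N : Matrix n n R) :
    (M * N).cofactorIdeal ≤ N.cofactorIdeal := by
  refine cofactorIdeal_le fun i j => ?_
  rw [adjugate_mul_distrib, mul_apply]
  exact Ideal.sum_mem _ fun l _ => Ideal.mul_mem_right _ _ (adjugate_mem_cofactorIdeal N _ _)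

theorem cofactorIdeal_mul_isUnit (M : Matrix n n R) {N : Matrix n n R} (hN : IsUnit N.det) :
    (M * N).cofactorIdeal = M.cofactorIdeal := by
  refine le_antisymm (cofactorIdeal_mul_le_left M N) ?_
  have := cofactorIdeal_mul_le_left (M * N) N⁻¹
  rwa [mul_nonsing_inv_cancel_right _ _ hN] at this

theorem cofactorIdeal_isUnit_mul {M : Matrix n n R} (hM : IsUnit M.det) (N : Matrix n n R) :
    (M * N).cofactorIdeal = N.cofactorIdeal := by
  refine le_antisymm (cofactorIdeal_mul_le_right M N) ?_
  have := cofactorIdeal_mul_le_right M⁻¹ (M * N)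
  rwa [nonsing_inv_mul_cancel_left _ _ hM] at this

theorem cofactorIdeal_submatrix_self (M : Matrix n n R) (e : α ≃ n) :
    (M.submatrix e e).cofactorIdeal = M.cofactorIdeal := by
  rw [cofactorIdeal, adjugate_submatrix_equiv_self, cofactorIdeal]
  congr 1
  ext x
  constructor
  · rintro ⟨p, rfl⟩
    exact ⟨(e p.1, e p.2), rfl⟩
  · rintro ⟨p, rfl⟩
    exact ⟨(e.symm p.1, e.symm p.2), by simp⟩

/-- Reindexing rows and columns differently is reindexing both by `e`, followed by multiplication
with a permutation matrix, which is invertible. -/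
theorem cofactorIdeal_submatrix (M : Matrix n n R) (e f : α ≃ n) :
    (M.submatrix e f).cofactorIdeal = M.cofactorIdeal := by
  have h : M.submatrix e f =
      M.submatrix e e * (1 : Matrix n n R).submatrix e f := by
    rw [submatrix_mul_equiv, mul_one]
  have hu : IsUnit ((1 : Matrix n n R).submatrix e f).det := by
    have h1 : (1 : Matrix n n R).submatrix e f * (1 : Matrix n n R).submatrix f e = 1 := by
      rw [submatrix_mul_equiv, one_mul, submatrix_one_equiv]
    exact IsUnit.of_mul_eq_one _ (by rw [← det_mul, h1, det_one])
  rw [h, cofactorIdeal_mul_isUnit _ hu, cofactorIdeal_submatrix_self]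

/-- Laplace expansion along a row. The empty matrix has determinant 1 and no cofactors, so an index
is needed. -/
theorem det_mem_cofactorIdeal [Nonempty n] (M : Matrix n n R) : M.det ∈ M.cofactorIdeal := by
  obtain ⟨i⟩ := ‹Nonempty n›
  have h : (M * M.adjugate) i i = M.det := by simp [mul_adjugate]
  rw [← h, mul_apply]
  exact Ideal.sum_mem _ fun l _ => Ideal.mul_mem_left _ _ (adjugate_mem_cofactorIdeal M _ _)

/-- Replacing a row of the identity block gives a multiple of `S.det`, which is in the ideal;
replacing a row of `S` gives a cofactor of `S`, or zero if the unit vector points into the other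
block. -/
theorem cofactorIdeal_fromBlocks_one [Nonempty β] (S : Matrix β β R) :
    (fromBlocks (1 : Matrix α α R) 0 0 S).cofactorIdeal = S.cofactorIdeal := by
  refine le_antisymm (cofactorIdeal_le fun i j => ?_) (cofactorIdeal_le fun i j => ?_)
  · rw [adjugate_apply]
    rcases j with j | j
    · have : (fromBlocks (1 : Matrix α α R) 0 0 S).updateRow (Sum.inl j) (Pi.single i 1) =
          fromBlocks ((1 : Matrix α α R).updateRow j fun a => (Pi.single i 1 : α ⊕ β → R) (Sum.inl a))
            ((0 : Matrix α β R).updateRow j fun b => (Pi.single i 1 : α ⊕ β → R) (Sum.inr b)) 0 S := by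
        ext (a | a) (b | b) <;> simp [updateRow_apply]
      rw [this, det_fromBlocks_zero₂₁]
      exact Ideal.mul_mem_left _ _ (det_mem_cofactorIdeal S)
    · have : (fromBlocks (1 : Matrix α α R) 0 0 S).updateRow (Sum.inr j) (Pi.single i 1) =
          fromBlocks 1 0
            ((0 : Matrix β α R).updateRow j fun a => (Pi.single i 1 : α ⊕ β → R) (Sum.inl a))
            (S.updateRow j fun b => (Pi.single i 1 : α ⊕ β → R) (Sum.inr b)) := by
        ext (a | a) (b | b) <;> simp [updateRow_apply]
      rw [this, det_fromBlocks_zero₁₂, det_one, one_mul]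
      rcases i with i | i
      · have h0 : (fun b => (Pi.single (Sum.inl i) 1 : α ⊕ β → R) (Sum.inr b)) = 0 := by
          ext b; simp
        rw [h0, det_eq_zero_of_row_eq_zero j (by simp)]
        exact Ideal.zero_mem _
      · have h0 : (fun b => (Pi.single (Sum.inr i) 1 : α ⊕ β → R) (Sum.inr b)) = Pi.single i 1 := by
          ext b; simp [Pi.single_apply]
        rw [h0, ← adjugate_apply]
        exact adjugate_mem_cofactorIdeal _ _ _
  · have : (fromBlocks (1 : Matrix α α R) 0 0 S).adjugate (Sum.inr i) (Sum.inr j) =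
        S.adjugate i j := by
      rw [adjugate_apply, adjugate_apply]
      have : (fromBlocks (1 : Matrix α α R) 0 0 S).updateRow (Sum.inr j)
          (Pi.single (Sum.inr i) 1) = fromBlocks 1 0 0 (S.updateRow j (Pi.single i 1)) := by
        ext (a | a) (b | b) <;> simp [updateRow_apply, Pi.single_apply]
      rw [this, det_fromBlocks_zero₁₂, det_one, one_mul]
    rw [← this]
    exact adjugate_mem_cofactorIdeal _ _ _

/-- Elimination of the columns `α` with the help of the rows `α` does not change the ideal of
cofactors.  The columns of `V` are solutions of the equations given by the rows `α`. -/
theorem cofactorIdeal_eliminate [Nonempty β] (M : Matrix n n R) (e f : α ⊕ β ≃ n)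
    (V : Matrix n β R) (hV : ∀ b, V (f (Sum.inr b)) = Pi.single b 1)
    (hMV : ∀ a, (M * V) (e (Sum.inl a)) = 0)
    (hA : IsUnit (of fun a a' => M (e (Sum.inl a)) (f (Sum.inl a'))).det) :
    M.cofactorIdeal = (of fun b => (M * V) (e (Sum.inr b))).cofactorIdeal := by
  set S : Matrix β β R := of fun b => (M * V) (e (Sum.inr b)) with hS
  set A : Matrix α α R := of fun a a' => M (e (Sum.inl a)) (f (Sum.inl a')) with hA'
  set C : Matrix β α R := of fun b a => M (e (Sum.inr b)) (f (Sum.inl a)) with hC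
  set X : Matrix α β R := of fun a b => V (f (Sum.inl a)) b with hX
  have hsum : ∀ p b, (M * V) p b =
      ∑ a, M p (f (Sum.inl a)) * V (f (Sum.inl a)) b + M p (f (Sum.inr b)) := by
    intro p b
    rw [mul_apply, ← f.sum_comp, Fintype.sum_sum_type]
    simp [hV, Pi.single_apply]
  -- Block elimination: the right factor makes the columns of `V` the new last columns, and on these
  -- the rows `α` vanish. Both triangular factors have unit determinant, 1 and `A.det`.
  have h1 : M.submatrix e f * fromBlocks 1 X 0 1 = fromBlocks A 0 C 1 * fromBlocks 1 0 0 S := by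
    rw [fromBlocks_multiply]
    ext (a | a) (b | b)
    · simp [mul_apply, hA', Fintype.sum_sum_type, one_apply]
    · have := congrFun (hMV a) b
      rw [hsum] at this
      simpa [mul_apply, hX, Fintype.sum_sum_type, one_apply] using this
    · simp [mul_apply, hC, Fintype.sum_sum_type, one_apply]
    · have := hsum (e (Sum.inr a)) b
      rw [mul_apply, Fintype.sum_sum_type]
      simpa [mul_apply, hX, hS, one_apply] using this.symm
  have hU : IsUnit (fromBlocks (1 : Matrix α α R) X 0 (1 : Matrix β β R)).det := by
    simp
  have hG : IsUnit (fromBlocks A 0 C (1 : Matrix β β R)).det := by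
    simpa using hA
  rw [← cofactorIdeal_submatrix M e f, ← cofactorIdeal_mul_isUnit _ hU, h1,
    cofactorIdeal_isUnit_mul hG, cofactorIdeal_fromBlocks_one]

/-- A matrix that is triangular with respect to a rank function is invertible if its diagonal
is. -/
theorem isUnit_det_of_rank (A : Matrix α α R) (r : α → ℕ) (hd : ∀ a, IsUnit (A a a))
    (h : ∀ a b, a ≠ b → r a ≤ r b → A a b = 0) : IsUnit A.det := by
  -- `BlockTriangular` asks for zeros below the diagonal, whereas here they lie above it; hence the
  -- reversed order.
  have ht : A.BlockTriangular (OrderDual.toDual ∘ r) := by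
    intro a b hab
    have hab : r a < r b := hab
    exact h a b (by rintro rfl; exact lt_irrefl _ hab) hab.le
  rw [ht.det]
  refine IsUnit.prod_iff.2 fun l _ => ?_
  have : A.toSquareBlock (OrderDual.toDual ∘ r) l =
      diagonal fun a => A a.1 a.1 := by
    ext ⟨a, ha⟩ ⟨b, hb⟩
    rw [diagonal_apply]
    split_ifs with hab
    · cases hab; rfl
    · refine h a b (fun h => hab (Subtype.ext h)) (le_of_eq ?_)
      exact OrderDual.toDual.injective (ha.trans hb.symm)
  rw [this, det_diagonal]
  exact IsUnit.prod_iff.2 fun a _ => hd _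

end Matrix

/-! ### Cyclic bidiagonal matrices -/

namespace Matrix

variable {R : Type*} [CommRing R] {m : ℕ} [NeZero m]

/-- The matrix with the entries `a i` on the diagonal and `-b (i + 1)` right of it, cyclically. -/
def cyclicBidiagonal (a b : Fin m → R) : Matrix (Fin m) (Fin m) R :=
  of fun i => Pi.single i (a i) - Pi.single (i + 1) (b (i + 1))

theorem cyclicBidiagonal_apply (a b : Fin m → R) (i j : Fin m) :
    cyclicBidiagonal a b i j = (if j = i then a i else 0) - if j = i + 1 then b (i + 1) else 0 := by
  simp [cyclicBidiagonal, Pi.single_apply]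

-- As soon as one index moves to its successor, injectivity forces the successor to move as well,
-- and so on around the cycle. These are the permutations that can contribute to the determinant
-- below.
open Fin.CommRing in
theorem eq_one_or_eq_finRotate {n : ℕ} (σ : Equiv.Perm (Fin (n + 2)))
    (h : ∀ i, σ i = i ∨ σ i = i + 1) : σ = 1 ∨ σ = finRotate (n + 2) := by
  by_cases h1 : ∃ i, σ i ≠ i
  · obtain ⟨i, hi⟩ := h1
    right
    have key : ∀ j, σ (i + j) = i + j + 1 := by
      intro j
      induction j using PretzelCrossing.column_induction with
      | h0 => simpa using (h i).resolve_left hi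
      | h j ih =>
        rw [← add_assoc]
        refine (h (i + j + 1)).resolve_left fun h' => ?_
        have := σ.injective (h'.trans ih.symm)
        simp at this
    ext1 j
    have := key (j - i)
    rw [finRotate_apply]
    rwa [add_sub_cancel] at this
  · push Not at h1
    exact Or.inl (Equiv.ext h1)

/-- Only the identity and the full rotation contribute. The sign `(-1)^(m-1)` of the rotation and
the `m` signs of the entries `-b` leave a single minus. For `m = 1` both entries share one position,
so this case is separate. -/
theorem det_cyclicBidiagonal (a b : Fin m → R) :
    (cyclicBidiagonal a b).det = ∏ i, a i - ∏ i, b i := by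
  obtain _ | _ | n := m
  · exact absurd rfl (NeZero.ne 0)
  · rw [det_fin_one, cyclicBidiagonal_apply]
    simp
  rw [← det_transpose, det_apply', Fintype.sum_eq_add 1 (finRotate (n + 2))]
  · rw [Equiv.Perm.sign_one, sign_finRotate, sub_eq_add_neg]
    congr 1
    · simp [cyclicBidiagonal_apply]
    · have : ∀ i : Fin (n + 2), (cyclicBidiagonal a b)ᵀ (finRotate (n + 2) i) i =
          -1 * b (finRotate (n + 2) i) := by
        intro i
        simp [cyclicBidiagonal_apply]
      rw [Finset.prod_congr rfl fun i _ => this i, Finset.prod_mul_distrib,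
        Equiv.prod_comp (finRotate (n + 2)) b]
      simp [pow_succ, ← mul_assoc, ← mul_pow]
  · intro h
    have := congrArg (fun σ : Equiv.Perm (Fin (n + 2)) => σ 0) h
    simp at this
  · rintro σ ⟨h1, h2⟩
    by_contra h
    refine (eq_one_or_eq_finRotate σ fun i => ?_).elim h1 h2
    have := fun h' => h (mul_eq_zero_of_right _ (Finset.prod_eq_zero (Finset.mem_univ i) h'))
    rw [transpose_apply, cyclicBidiagonal_apply] at this
    by_contra! hi
    exact this (by simp [hi])

/-- The matrix of the cyclic differences `x i - x (i + 1)`. -/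
abbrev cyclicDifference (R : Type*) [CommRing R] (m : ℕ) [NeZero m] : Matrix (Fin m) (Fin m) R :=
  cyclicBidiagonal 1 1

/-- The determinant is zero, so the columns of the adjugate lie in the kernel, whose vectors are
constant. It remains to find a diagonal entry: putting a unit vector into the row `j` amounts to
setting `b (j + 1) = 0`, which makes the determinant 1. -/
theorem adjugate_cyclicDifference (i j : Fin m) : (cyclicDifference R m).adjugate i j = 1 := by
  have hrow : ∀ i : Fin m, (cyclicDifference R m).adjugate i j =
      (cyclicDifference R m).adjugate 0 j := by
    intro i
    induction i using PretzelCrossing.column_induction with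
    | h0 => rfl
    | h i ih =>
      rw [← ih]
      have := congrFun (congrFun (mul_adjugate (cyclicDifference R m)) i) j
      rw [det_cyclicBidiagonal] at this
      simp [mul_apply, cyclicBidiagonal_apply, sub_mul] at this
      exact (sub_eq_zero.1 this).symm
  rw [hrow i, ← hrow j, adjugate_apply]
  have : (cyclicDifference R m).updateRow j (Pi.single j 1) =
      cyclicBidiagonal 1 (Function.update 1 (j + 1) 0) := by
    ext i l
    by_cases h : i = j
    · subst h
      simp [cyclicBidiagonal_apply, Pi.single_apply]
    · simp [cyclicBidiagonal_apply, updateRow_apply, h]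
  have h0 : ∏ i, Function.update (1 : Fin m → R) (j + 1) 0 i = 0 :=
    Finset.prod_eq_zero (Finset.mem_univ (j + 1)) (by simp)
  rw [this, det_cyclicBidiagonal, h0]
  simp

/-- All cofactors of the matrix are equal. -/
theorem exists_cofactorIdeal_cyclic [IsDomain R] (a b : Fin m → R) (y : R) (hy : y ≠ 0)
    (h : ∀ i, a i - b i = y) :
    ∃ c : R, (cyclicBidiagonal a b * cyclicDifference R m).cofactorIdeal = Ideal.span {c} ∧
      y * c = ∏ i, a i - ∏ i, b i := by
  set W := cyclicBidiagonal a b with hW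
  -- Every column of `W` contains one `a l` and one `-b l`, so its sum is `y`. The all-ones row
  -- vector is thus a left eigenvector of `W`; multiply by the adjugate.
  have h1 : ∀ j, y * ∑ i, W.adjugate i j = W.det := by
    intro j
    have hcol : ∀ l, ∑ i, W i l = y := by
      intro l
      simp only [hW, cyclicBidiagonal_apply, Finset.sum_sub_distrib]
      rw [Finset.sum_eq_single l (by intro i _ hi; rw [if_neg hi.symm]) (by simp),
        Finset.sum_eq_single (l - 1) ?_ (by simp)]
      · simp [h]
      · intro i _ hi
        rw [if_neg]
        rintro rfl
        simp at hi
    have h2 : ∑ i, (W * W.adjugate) i j = W.det := by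
      rw [mul_adjugate]
      simp [one_apply]
    rw [← h2]
    simp only [mul_apply]
    rw [Finset.sum_comm, Finset.mul_sum]
    exact Finset.sum_congr rfl fun l _ => by rw [← Finset.sum_mul, hcol]
  refine ⟨∑ i, W.adjugate i 0, ?_, by rw [h1, det_cyclicBidiagonal]⟩
  -- The adjugate of the difference matrix consists of ones, so the cofactors of the product are
  -- column sums of `W.adjugate`; these agree because `y` can be cancelled.
  have hadj : ∀ i j, (W * cyclicDifference R m).adjugate i j = ∑ i, W.adjugate i 0 := by
    intro i j
    rw [adjugate_mul_distrib, mul_apply]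
    simp only [adjugate_cyclicDifference, one_mul]
    exact mul_left_cancel₀ hy ((h1 j).trans (h1 0).symm)
  rw [cofactorIdeal]
  congr 1
  ext x
  simp only [hadj, Set.mem_range, Set.mem_singleton_iff]
  exact ⟨fun ⟨_, h⟩ => h.symm, fun h => ⟨(0, 0), h.symm⟩⟩

end Matrix

/-! ### Substitutions, Fibonacci polynomials and a closed form of the Conway polynomial -/

namespace KnotDiagram

open LaurentPolynomial

/-- `KnotDiagram.substPow` as a ring homomorphism. -/
noncomputable def substPowHom (m : ℤ) : ℤ[T;T⁻¹] →+* ℤ[T;T⁻¹] :=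
  AddMonoidAlgebra.mapDomainRingHom ℤ (AddMonoidHom.mulLeft m)

theorem substPowHom_apply (m : ℤ) (f : ℤ[T;T⁻¹]) : substPowHom m f = substPow m f := rfl

@[simp]
theorem substPowHom_T (m n : ℤ) : substPowHom m (T n) = T (m * n) := by
  rw [substPowHom_apply, substPow, T, AddMonoidAlgebra.mapDomain_single]
  rfl

theorem substPowHom_injective {m : ℤ} (hm : m ≠ 0) : Function.Injective (substPowHom m) :=
  AddMonoidAlgebra.mapDomain_injective (mul_right_injective₀ hm)

/-- `KnotDiagram.evalOne` as a ring homomorphism. -/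
noncomputable def evalOneHom : ℤ[T;T⁻¹] →+* ℤ := eval₂ (RingHom.id ℤ) 1

theorem evalOneHom_apply (f : ℤ[T;T⁻¹]) : evalOneHom f = evalOne f := rfl

@[simp]
theorem evalOneHom_T (n : ℤ) : evalOneHom (T n) = 1 := by
  simp [evalOneHom, eval₂_T]

end KnotDiagram

theorem prod_mul_add_eq_sum_elemSymm {R : Type*} [CommRing R] {m : ℕ} (k : Fin m → ℤ) (z x : R) :
    ∏ i, ((k i : R) * z + x) =
      ∑ n ∈ Finset.range (m + 1), (elemSymm n k : R) * z ^ n * x ^ (m - n) := by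
  rw [Finset.prod_add, Finset.sum_powerset, Finset.card_univ, Fintype.card_fin]
  refine Finset.sum_congr rfl fun n _ => ?_
  rw [elemSymm, Int.cast_sum, Finset.sum_mul, Finset.sum_mul]
  refine Finset.sum_congr rfl fun P hP => ?_
  rw [Finset.mem_powersetCard_univ] at hP
  rw [Finset.prod_mul_distrib, Finset.prod_const, Finset.prod_const, Finset.card_sdiff,
    Finset.inter_univ, hP, Finset.card_univ, Fintype.card_fin, Int.cast_prod]

namespace Polynomial

theorem map_aeval_int {R S : Type*} [CommRing R] [CommRing S] [Algebra ℤ R] [Algebra ℤ S]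
    (f : R →+* S) (x : R) (p : ℤ[X]) : f (aeval x p) = aeval (f x) p := by
  rw [aeval_def, hom_eval₂, aeval_def]
  congr 1
  exact RingHom.ext_int _ _

/-- The Fibonacci polynomials. -/
noncomputable def fibonacci : ℕ → ℤ[X]
  | 0 => 0
  | 1 => 1
  | n + 2 => X * fibonacci (n + 1) + fibonacci n

/-- Binet's formula: `x` and `-y` are the roots of `X² - (x - y) X - 1`, so their powers satisfy the
recursion. -/
theorem add_mul_aeval_fibonacci {R : Type*} [CommRing R] [Algebra ℤ R] {x y : R} (h : x * y = 1) (n : ℕ) :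
    (x + y) * aeval (x - y) (fibonacci n) = x ^ n - (-y) ^ n := by
  induction n using fibonacci.induct with
  | case1 => simp [fibonacci]
  | case2 => simp [fibonacci]
  | case3 n h1 h2 =>
    rw [fibonacci, map_add, map_mul, aeval_X, mul_add, mul_left_comm, h1, h2]
    simp only [Nat.succ_eq_add_one, Nat.add_assoc, pow_add]
    linear_combination (-x ^ n + (-y) ^ n) * h

/-- Fibonacci polynomials of odd index are even and those of even index are odd. The parity is
needed to pass from `z` to `z² = t - 2 + t⁻¹`, which involves no square root of `t`. -/
theorem exists_expand_fibonacci (n : ℕ) :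
    (∃ p, expand ℤ 2 p = fibonacci (2 * n + 1)) ∧ ∃ p, expand ℤ 2 p = X * fibonacci (2 * n) := by
  induction n with
  | zero => exact ⟨⟨1, by simp [fibonacci]⟩, 0, by simp [fibonacci]⟩
  | succ n ih =>
    obtain ⟨⟨p, hp⟩, q, hq⟩ := ih
    have h2 : ∃ r, expand ℤ 2 r = X * fibonacci (2 * (n + 1)) := by
      refine ⟨X * p + q, ?_⟩
      rw [show 2 * (n + 1) = 2 * n + 2 by ring, fibonacci, map_add, map_mul, hp, hq, expand_X]
      ring
    obtain ⟨r, hr⟩ := h2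
    refine ⟨⟨r + p, ?_⟩, r, hr⟩
    rw [show 2 * (n + 1) + 1 = 2 * n + 1 + 2 by ring, fibonacci, map_add, hr, hp]
    rfl

theorem coeff_fibonacci (n : ℕ) :
    ((fibonacci (2 * n + 1)).coeff 0 = 1 ∧ (fibonacci (2 * n)).coeff 0 = 0) ∧
      (fibonacci (2 * n)).coeff 1 = n ∧
      ((fibonacci (2 * n + 1)).coeff 2 : ℚ) = 1 / 2 * n * (n + 1) := by
  induction n with
  | zero => simp [fibonacci, coeff_one]
  | succ n ih =>
    obtain ⟨⟨h1, h2⟩, h3, h4⟩ := ih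
    have e0 : fibonacci (2 * (n + 1)) = X * fibonacci (2 * n + 1) + fibonacci (2 * n) := rfl
    have e1 : fibonacci (2 * (n + 1) + 1) = X * fibonacci (2 * (n + 1)) + fibonacci (2 * n + 1) :=
      rfl
    have h3' : (fibonacci (2 * (n + 1))).coeff 1 = (n : ℤ) + 1 := by
      rw [e0, coeff_add, coeff_X_mul, h1, h3]; ring
    refine ⟨⟨?_, ?_⟩, ?_, ?_⟩
    · rw [e1, coeff_add, mul_coeff_zero]; simp [h1]
    · rw [e0, coeff_add, mul_coeff_zero]; simp [h2]
    · rw [h3']; push_cast; ring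
    · rw [e1, coeff_add, coeff_X_mul, h3']
      push_cast
      rw [h4]
      ring

end Polynomial

open Polynomial in
/-- The Conway polynomial of a pretzel knot with odd columns. -/
noncomputable def pretzelConway {m : ℕ} (k : Fin m → ℤ) : ℤ[X] :=
  ∑ n ∈ Finset.range (m + 1), C (elemSymm n k) * X ^ n * fibonacci (m - n)

namespace pretzelConway

open Polynomial

/-- Expand both products by elementary symmetric polynomials and apply Binet's formula to each
difference of powers. The right-hand side is what the Alexander matrix yields. -/
theorem add_mul_aeval {R : Type*} [CommRing R] [Algebra ℤ R] {m : ℕ} (k : Fin m → ℤ) {x y : R}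
    (h : x * y = 1) :
    (x + y) * aeval (x - y) (pretzelConway k) =
      ∏ i, ((k i : R) * (x - y) + x) - ∏ i, ((k i : R) * (x - y) - y) := by
  simp only [sub_eq_add_neg _ y]
  rw [prod_mul_add_eq_sum_elemSymm, prod_mul_add_eq_sum_elemSymm, ← Finset.sum_sub_distrib,
    pretzelConway, map_sum, Finset.mul_sum]
  refine Finset.sum_congr rfl fun n _ => ?_
  have := add_mul_aeval_fibonacci h (m - n)
  rw [map_mul, map_mul, map_pow, aeval_X, aeval_C]
  rw [sub_eq_add_neg] at this
  simp only [eq_intCast]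
  linear_combination (elemSymm n k : R) * (x + -y) ^ n * this

theorem exists_expand {g : ℕ} (k : Fin (2 * g + 1) → ℤ) :
    ∃ p, expand ℤ 2 p = pretzelConway k := by
  change pretzelConway k ∈ (expand ℤ 2).range
  refine sum_mem fun n hn => ?_
  rw [Finset.mem_range] at hn
  obtain ⟨l, rfl | rfl⟩ := Nat.even_or_odd' n
  · obtain ⟨p, hp⟩ := (exists_expand_fibonacci (g - l)).1
    refine ⟨C (elemSymm (2 * l) k) * X ^ l * p, ?_⟩
    change expand ℤ 2 _ = _
    rw [map_mul, map_mul, map_pow, hp, expand_C, expand_X,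
      show 2 * g + 1 - 2 * l = 2 * (g - l) + 1 by omega, pow_mul]
  · obtain ⟨p, hp⟩ := (exists_expand_fibonacci (g - l)).2
    refine ⟨C (elemSymm (2 * l + 1) k) * X ^ l * p, ?_⟩
    change expand ℤ 2 _ = _
    rw [map_mul, map_mul, map_pow, hp, expand_C, expand_X,
      show 2 * g + 1 - (2 * l + 1) = 2 * (g - l) by omega]
    ring

theorem coeff_le_two {m : ℕ} (k : Fin m → ℤ) (d : ℕ) :
    (pretzelConway k).coeff d = ∑ n ∈ Finset.range (m + 1),
      if n ≤ d then elemSymm n k * (fibonacci (m - n)).coeff (d - n) else 0 := by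
  rw [pretzelConway, finsetSum_coeff]
  refine Finset.sum_congr rfl fun n _ => ?_
  rw [mul_assoc, coeff_C_mul, coeff_X_pow_mul']
  split_ifs <;> simp

theorem elemSymm_zero {m : ℕ} (k : Fin m → ℤ) : elemSymm 0 k = 1 := by
  simp [elemSymm]

theorem coeff_zero {g : ℕ} (k : Fin (2 * g + 1) → ℤ) : (pretzelConway k).coeff 0 = 1 := by
  rw [coeff_le_two, Finset.sum_eq_single 0]
  · simp [elemSymm_zero, (coeff_fibonacci g).1.1]
  · intro n _ hn
    rw [if_neg (by omega)]
  · simp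

theorem coeff_two {g : ℕ} (k : Fin (2 * g + 1) → ℤ) :
    ((pretzelConway k).coeff 2 : ℚ) =
      1 / 2 * g * (g + 1) + g * elemSymm 1 k + elemSymm 2 k := by
  rw [coeff_le_two]
  -- With a single column the sum has no term of index 2, and the second elementary symmetric
  -- polynomial is zero.
  obtain _ | g := g
  · simp [Finset.sum_range_succ, elemSymm, Finset.powersetCard_eq_empty.2, fibonacci, coeff_one]
  · rw [show 2 * (g + 1) + 1 + 1 = (2 * g + 1) + 1 + 1 + 1 by ring, Finset.sum_range_succ',
      Finset.sum_range_succ', Finset.sum_range_succ', Finset.sum_eq_zero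
      fun n _ => if_neg (by omega)]
    have h0 := (coeff_fibonacci (g + 1)).2.2
    have h1 := (coeff_fibonacci (g + 1)).2.1
    have h2 := (coeff_fibonacci g).1.1
    simp only [elemSymm_zero, Nat.reduceAdd, Nat.zero_add, le_refl, if_true, Nat.sub_self,
      Nat.one_le_ofNat, Nat.zero_le, Nat.sub_zero, Nat.reduceSub,
      show 2 * (g + 1) + 1 - 2 = 2 * g + 1 by omega, show 2 * (g + 1) + 1 - 1 = 2 * (g + 1) by omega,
      h1, h2]
    push_cast at h0 ⊢
    rw [h0]
    ring

end pretzelConway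

/-! ### Fox colourings and the Alexander ideal -/

namespace KnotDiagram

open LaurentPolynomial Matrix

variable {C : Type} [Fintype C] [DecidableEq C]

theorem alexanderMatrix_mulVec (D : KnotDiagram C) (v : C × Bool → ℤ[T;T⁻¹]) (p : C × Bool) :
    (D.alexanderMatrix *ᵥ v) p =
      if p.2 = true then v (D.next p) - v p
      else if D.sign p.1 = 1 then v (D.next p) - T 1 * v p - (1 - T 1) * v (p.1, true)
      else v p - T 1 * v (D.next p) - (1 - T 1) * v (p.1, true) := by
  have h : D.alexanderMatrix p = if p.2 = true then Pi.single (D.next p) 1 - Pi.single p 1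
    else if D.sign p.1 = 1 then
      Pi.single (D.next p) 1 - Pi.single p (T 1) - Pi.single (p.1, true) (1 - T 1)
    else
      Pi.single p 1 - Pi.single (D.next p) (T 1) - Pi.single (p.1, true) (1 - T 1) := rfl
  change D.alexanderMatrix p ⬝ᵥ v = _
  rw [h]
  split_ifs <;> simp only [sub_dotProduct, single_dotProduct, one_mul]

theorem alexanderIdeal_eq (D : KnotDiagram C) :
    D.alexanderIdeal = D.alexanderMatrix.cofactorIdeal := rfl

end KnotDiagram

namespace PretzelCrossing

variable {m : ℕ} {k : Fin m → ℤ}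

theorem crossing_ext_iff {c c' : PretzelCrossing k} :
    c = c' ↔ c.1 = c'.1 ∧ c.2.val = c'.2.val := by
  obtain ⟨i, j, hj⟩ := c
  obtain ⟨i', j', hj'⟩ := c'
  constructor
  · rintro h
    cases h
    exact ⟨rfl, rfl⟩
  · rintro ⟨rfl, rfl⟩
    rfl

theorem passage_inj {c c' : PretzelCrossing k} {d d' : Bool} :
    passage k c d = passage k c' d' ↔ c = c' ∧ d = d' := by
  constructor
  · intro h
    have h1 : c = c' := congrArg Prod.fst h
    subst h1
    refine ⟨rfl, ?_⟩
    rw [← descends_passage k c d, h, descends_passage]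
  · rintro ⟨rfl, rfl⟩
    rfl

theorem passage_snd (c : PretzelCrossing k) (d : Bool) :
    (passage k c d).2 = ((d == decide (Odd c.2.val)) == decide (0 ≤ k c.1)) := rfl

theorem passage_fst (c : PretzelCrossing k) (d : Bool) : (passage k c d).1 = c := rfl

/-- The two strands of a half twist run in opposite vertical directions, so the strand over an
under-passage is the one of the other direction. -/
theorem mk_true_eq_passage (c : PretzelCrossing k) (d : Bool) (h : (passage k c d).2 = false) :
    (c, true) = passage k c !d := by
  rw [passage_snd] at h
  simp only [passage, Prod.mk.injEq, true_and]
  revert h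
  cases d <;> cases decide (Odd c.2.val) <;> cases decide (0 ≤ k c.1) <;> decide

end PretzelCrossing

open KnotDiagram LaurentPolynomial Matrix PretzelCrossing

theorem pretzelKnot_alexanderMatrix_mulVec {g : ℕ} (k : Fin (2 * g + 1) → ℤ)
    (v : PretzelCrossing k × Bool → ℤ[T;T⁻¹]) (c : PretzelCrossing k) (d : Bool) :
    ((pretzelKnot k).alexanderMatrix *ᵥ v) (passage k c d) =
      if ((d == decide (Odd c.2.val)) == decide (0 ≤ k c.1)) = true then
        v (follow k c d) - v (passage k c d)
      else if 0 ≤ k c.1 then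
        v (passage k c d) - T 1 * v (follow k c d) - (1 - T 1) * v (passage k c !d)
      else v (follow k c d) - T 1 * v (passage k c d) - (1 - T 1) * v (passage k c !d) := by
  have hn : (pretzelKnot k).next (passage k c d) = follow k c d := next_passage k c d
  have hs : (pretzelKnot k).sign (passage k c d).1 = if 0 ≤ k c.1 then -1 else 1 := rfl
  rw [alexanderMatrix_mulVec, hn, hs, ← passage_snd]
  by_cases h : (passage k c d).2 = true
  · rw [if_pos h, if_pos h]
  · rw [if_neg h, if_neg h, passage_fst,
      mk_true_eq_passage c d (Bool.not_eq_true _ ▸ h)]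
    by_cases h0 : 0 ≤ k c.1
    · simp [h0]
    · simp [h0]

namespace PretzelCrossing

section GapValue

variable {R : Type*} [CommRing R] (t τ : R)

/-- The value of a Fox colouring on the left-hand (`r = false`) or right-hand (`r = true`)
strand after `l` half twists of a column, when the values on the strands at the upper end
are `x` and `y`. -/
def gapValue (κ : ℤ) (x y : R) (l : ℕ) (r : Bool) : R :=
  if 0 ≤ κ then
    if Even l then (if r then y else x) + (l / 2 : ℕ) * (τ - 1) * (x - y)
    else y + (l / 2 : ℕ) * (τ - 1) * (x - y) + (if r then τ * (x - y) else 0)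
  else
    if Even l then (if r then y else x) - (l / 2 : ℕ) * (τ - 1) * (x - y)
    else x - (l / 2 : ℕ) * (τ - 1) * (x - y) - (if r then 0 else τ * (x - y))

variable {t τ} (κ : ℤ) (x y : R)

theorem gapValue_zero (r : Bool) : gapValue τ κ x y 0 r = if r then y else x := by
  simp [gapValue]

/-- The value of a Fox colouring is determined by the relation at a crossing. -/
theorem gapValue_relation (ht : t * τ = 1) (l : ℕ) (d : Bool) :
    let o := decide (Odd l)
    let V : Bool → R := fun d => gapValue τ κ x y (if d then l else l + 1) o
    let W : Bool → R := fun d => gapValue τ κ x y (if d then l + 1 else l) (!o)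
    (if ((d == o) == decide (0 ≤ κ)) = true then W d - V d
      else if 0 ≤ κ then V d - t * W d - (1 - t) * V (!d)
      else W d - t * V d - (1 - t) * V (!d)) = 0 := by
  -- The edge that enters the half twist `l` downwards lies in the gap `l`, the one that enters it
  -- upwards in the gap `l + 1`, both on the right exactly if `l` is odd. The edges `W` that leave
  -- lie on the other side.
  intro o V W
  have tf : (true == false) = false := rfl
  have ft : (false == true) = false := rfl
  obtain ⟨a, rfl | rfl⟩ := Nat.even_or_odd' l
  · have he : ¬ Odd (2 * a) := by simp
    have e1 : Even (2 * a) := by simp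
    have e2 : ¬ Even (2 * a + 1) := by simp
    have e3 : (2 * a + 1) / 2 = a := by omega
    have e4 : 2 * a / 2 = a := by omega
    by_cases h : 0 ≤ κ <;> cases d <;>
      simp only [o, V, W, gapValue, h, he, e1, e2, e3, e4, decide_false, decide_true, if_true,
        if_false, beq_self_eq_true, Bool.not_false, Bool.not_true, Bool.false_eq_true, tf, ft] <;>
    first
    | ring1
    | linear_combination (x - y) * ht
    | linear_combination (y - x) * ht
  · have he : Odd (2 * a + 1) := by simp
    have e1 : ¬ Even (2 * a + 1) := by simp
    have e2 : Even (2 * a + 1 + 1) := by rw [Nat.even_add_one]; simp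
    have e3 : (2 * a + 1 + 1) / 2 = a + 1 := by omega
    have e4 : (2 * a + 1) / 2 = a := by omega
    by_cases h : 0 ≤ κ <;> cases d <;>
      simp only [o, V, W, gapValue, h, he, e1, e2, e3, e4, decide_false, decide_true, if_true,
        if_false, beq_self_eq_true, Bool.not_false, Bool.not_true, Bool.false_eq_true, tf, ft] <;> push_cast <;>
    first
    | ring1
    | linear_combination (x - y) * ht
    | linear_combination (y - x) * ht

/-- Right-handed and left-handed columns end with the same expression in `κ`. This is why the
remaining relations need no distinction by sign, apart from unit factors. -/
theorem gapValue_bottom (r : Bool) :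
    gapValue τ κ x y (2 * κ + 1).natAbs r =
      y + κ * (τ - 1) * (x - y) + if r then τ * (x - y) else 0 := by
  by_cases h : 0 ≤ κ
  · obtain ⟨a, rfl⟩ := Int.eq_ofNat_of_zero_le h
    rw [show (2 * (a : ℤ) + 1).natAbs = 2 * a + 1 by omega, gapValue, if_pos h, if_neg (by simp),
      show (2 * a + 1) / 2 = a by omega]
    simp
  -- A column with `κ = -a - 1` has `2 a + 1` half twists, as many as one with `κ = a`.
  · obtain ⟨a, rfl⟩ : ∃ a : ℕ, κ = -(a : ℤ) - 1 := ⟨(-κ - 1).toNat, by omega⟩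
    rw [show (2 * (-(a : ℤ) - 1) + 1).natAbs = 2 * a + 1 by omega, gapValue, if_neg h,
      if_neg (by simp), show (2 * a + 1) / 2 = a by omega]
    cases r <;> simp <;> ring

end GapValue

end PretzelCrossing

namespace PretzelCrossing

variable {m : ℕ} [NeZero m] {k : Fin m → ℤ}

/-- The Fox colouring of the edges with given colours at the upper ends of the columns. It can
violate the relations at the lower ends. -/
def colour {R : Type*} [CommRing R] (τ : R) (x : Fin m → R) (p : PretzelCrossing k × Bool) : R :=
  gapValue τ (k p.1.1) (x p.1.1) (x (p.1.1 + 1))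
    (if descends k p then p.1.2.val else p.1.2.val + 1) (decide (Odd p.1.2.val))

section

variable {R : Type*} [CommRing R] (τ : R) (x : Fin m → R)

theorem colour_passage (c : PretzelCrossing k) (d : Bool) :
    colour τ x (passage k c d) = gapValue τ (k c.1) (x c.1) (x (c.1 + 1))
      (if d then c.2.val else c.2.val + 1) (decide (Odd c.2.val)) := by
  rw [colour, descends_passage]
  rfl

theorem colour_top (i : Fin m) : colour τ x (passage k (top k i) true) = x i := by
  rw [colour_passage]
  simp [top, gapValue_zero]

theorem colour_follow_down (c : PretzelCrossing k) (h : c.2.val + 1 < (2 * k c.1 + 1).natAbs) :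
    colour τ x (follow k c true) = gapValue τ (k c.1) (x c.1) (x (c.1 + 1))
      (c.2.val + 1) (!decide (Odd c.2.val)) := by
  obtain ⟨i, j, hj⟩ := c
  rw [follow_down i j h, colour_passage]
  simp [Nat.odd_add_one, -Nat.not_odd_iff_even]

theorem colour_follow_up (c : PretzelCrossing k) :
    colour τ x (follow k c false) = gapValue τ (k c.1) (x c.1) (x (c.1 + 1))
      c.2.val (!decide (Odd c.2.val)) := by
  obtain ⟨i, j, hj⟩ := c
  obtain _ | j := j
  · change colour τ x (follow k (top k i) false) = _
    rw [← next_passage, next_up_top, colour_top]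
    simp [gapValue_zero]
  · rw [follow_up i j hj, colour_passage]
    simp [Nat.odd_add_one, -Nat.not_odd_iff_even]

omit [NeZero m] in
theorem bottom_val_add_one (i : Fin m) : (bottom k i).2.val + 1 = (2 * k i + 1).natAbs := by
  simp only [bottom]
  omega

omit [NeZero m] in
theorem not_odd_bottom (i : Fin m) : ¬ Odd (bottom k i).2.val :=
  Nat.not_odd_iff_even.2 (even_bottom k i)

theorem colour_follow_bottom (i : Fin m) :
    colour τ x (follow k (bottom k i) true) =
      x (i + 1 + 1) + k (i + 1) * (τ - 1) * (x (i + 1) - x (i + 1 + 1)) := by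
  rw [← next_passage, next_down_bottom, colour_passage, if_neg (by decide), bottom_val_add_one,
    decide_eq_false (not_odd_bottom _)]
  change gapValue τ (k (i + 1)) (x (i + 1)) (x (i + 1 + 1)) _ _ = _
  rw [gapValue_bottom]
  simp

end

theorem colour_relation {g : ℕ} {k : Fin (2 * g + 1) → ℤ} (x : Fin (2 * g + 1) → ℤ[T;T⁻¹])
    (c : PretzelCrossing k) (d : Bool) (h : d = true → c.2.val + 1 < (2 * k c.1 + 1).natAbs) :
    ((pretzelKnot k).alexanderMatrix *ᵥ colour (T (-1)) x) (passage k c d) = 0 := by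
  have key := gapValue_relation (t := (T 1 : ℤ[T;T⁻¹])) (τ := T (-1)) (k c.1) (x c.1)
    (x (c.1 + 1)) (by rw [← T_add]; rfl) c.2.val d
  rw [pretzelKnot_alexanderMatrix_mulVec, colour_passage, colour_passage]
  have hf : colour (T (-1)) x (follow k c d) = gapValue (T (-1)) (k c.1) (x c.1) (x (c.1 + 1))
      (if d then c.2.val + 1 else c.2.val) (!decide (Odd c.2.val)) := by
    cases d
    · exact colour_follow_up _ _ c
    · exact colour_follow_down _ _ c (h rfl)
  rw [hf]
  exact key

/-- The relation would hold if the leaving edge had the colour prescribed by the column `i` at its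
lower right end, by `gapValue_relation`. It actually has the colour prescribed by the next column at
its lower left end. What remains is the difference of the two, times the coefficient of the leaving
edge up to sign, which is a unit. -/
theorem colour_bottom {g : ℕ} {k : Fin (2 * g + 1) → ℤ} (x : Fin (2 * g + 1) → ℤ[T;T⁻¹])
    (i : Fin (2 * g + 1)) :
    ((pretzelKnot k).alexanderMatrix *ᵥ colour (T (-1)) x) (passage k (bottom k i) true) =
      (if 0 ≤ k i then T 1 else -1 : ℤ[T;T⁻¹]) *
        (((k i : ℤ[T;T⁻¹]) * (T (-1) - 1) + T (-1)) * (x i - x (i + 1)) -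
          ((k (i + 1) : ℤ[T;T⁻¹]) * (T (-1) - 1) - 1) * (x (i + 1) - x (i + 1 + 1))) := by
  have ht : (T 1 * T (-1) : ℤ[T;T⁻¹]) = 1 := by rw [← T_add]; rfl
  have key := gapValue_relation (t := (T 1 : ℤ[T;T⁻¹])) (τ := T (-1)) (k i) (x i)
    (x (i + 1)) ht (bottom k i).2.val true
  rw [pretzelKnot_alexanderMatrix_mulVec, colour_passage, colour_passage, colour_follow_bottom]
  simp only [decide_eq_false (not_odd_bottom (k := k) i), bottom_val_add_one, gapValue_bottom,
    if_true, Bool.not_true, Bool.not_false, Bool.false_eq_true, if_false] at key ⊢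
  simp only [show (bottom k i).1 = i from rfl, gapValue_bottom] at key ⊢
  by_cases h : 0 ≤ k i
  · simp [h] at key ⊢
    linear_combination key
  · simp [h] at key ⊢
    linear_combination key

/-- The edges that are eliminated from the Alexander matrix: all the ascending edges, and all the
descending ones except those at the upper ends of the columns. -/
abbrev Eliminated (k : Fin m → ℤ) : Type :=
  ((i : Fin m) × Fin ((2 * k i + 1).natAbs - 1)) ⊕ PretzelCrossing k

/-- The edges as columns of the Alexander matrix. -/
def columnIndex : Eliminated k ⊕ Fin m → PretzelCrossing k × Bool
  | .inl (.inl ⟨i, j⟩) => passage k ⟨i, ⟨j.val + 1, by omega⟩⟩ true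
  | .inl (.inr c) => passage k c false
  | .inr i => passage k (top k i) true

/-- The relations as rows of the Alexander matrix. -/
def rowIndex : Eliminated k ⊕ Fin m → PretzelCrossing k × Bool
  | .inl (.inl ⟨i, j⟩) => passage k ⟨i, ⟨j.val, by omega⟩⟩ true
  | .inl (.inr c) => passage k c false
  | .inr i => passage k (bottom k i) true

omit [NeZero m] in
theorem card_eliminated :
    Fintype.card (Eliminated k ⊕ Fin m) = Fintype.card (PretzelCrossing k × Bool) := by
  simp only [Fintype.card_sum, Fintype.card_fin, Fintype.card_bool, Fintype.card_sigma,
    Fintype.card_prod]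
  have : ∑ i : Fin m, (2 * k i + 1).natAbs = ∑ i : Fin m, (((2 * k i + 1).natAbs - 1) + 1) :=
    Finset.sum_congr rfl fun i _ => by omega
  rw [this, Finset.sum_add_distrib]
  simp
  ring

omit [NeZero m] in
theorem columnIndex_bijective : Function.Bijective (columnIndex (k := k)) := by
  rw [Fintype.bijective_iff_injective_and_card]
  refine ⟨?_, card_eliminated⟩
  rintro ((⟨i, j⟩ | c) | i) ((⟨i', j'⟩ | c') | i') h <;>
    simp only [columnIndex, passage_inj, crossing_ext_iff, top, reduceCtorEq, and_false, and_true,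
      Nat.add_right_cancel_iff] at h
  · obtain ⟨rfl, h⟩ := h
    simp [Fin.ext h]
  · rw [crossing_ext_iff.2 h]
  · rw [h]

omit [NeZero m] in
theorem rowIndex_bijective : Function.Bijective (rowIndex (k := k)) := by
  rw [Fintype.bijective_iff_injective_and_card]
  refine ⟨?_, card_eliminated⟩
  rintro ((⟨i, j⟩ | c) | i) ((⟨i', j'⟩ | c') | i') h <;>
    simp only [rowIndex, passage_inj, crossing_ext_iff, bottom, reduceCtorEq, and_false, and_true]
      at h
  · obtain ⟨rfl, h⟩ := h
    simp [Fin.ext h]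
  · obtain ⟨rfl, h⟩ := h
    omega
  · rw [crossing_ext_iff.2 h]
  · obtain ⟨rfl, h⟩ := h
    omega
  · rw [h.1]

/-- The order of elimination. -/
def eliminationRank : Eliminated k → ℕ
  | .inl ⟨_, j⟩ => 2 * j.val + 2
  | .inr c => 2 * c.2.val + 1

/-- Colours propagate downwards. The relation of a descending passage is solved for the edge that
leaves it, that of an ascending passage for the edge that enters it; the coefficients are units. The
other edges in these relations have smaller rank or are the uneliminated ones at the upper ends. -/
theorem isUnit_det_eliminated {g : ℕ} (k : Fin (2 * g + 1) → ℤ) :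
    IsUnit (of fun a a' => (pretzelKnot k).alexanderMatrix
      (rowIndex (.inl a)) (columnIndex (.inl a'))).det := by
  have hentry : ∀ p q, (pretzelKnot k).alexanderMatrix p q =
      ((pretzelKnot k).alexanderMatrix *ᵥ Pi.single q 1) p := by
    intro p q
    rw [mulVec_single_one]
    rfl
  have h1 : (T 1 : ℤ[T;T⁻¹]) ≠ 0 := (isUnit_T 1).ne_zero
  have hup : ∀ c : PretzelCrossing k, follow k c false =
      if h : 0 < c.2.val then passage k ⟨c.1, ⟨c.2.val - 1, by omega⟩⟩ false
      else passage k (top k (c.1 + 1)) true := by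
    rintro ⟨i, j⟩
    rw [follow]
    split_ifs <;> rfl
  refine isUnit_det_of_rank _ eliminationRank ?_ ?_
  · rintro (⟨i, j⟩ | c)
    · simp only [of_apply, hentry, rowIndex, columnIndex, pretzelKnot_alexanderMatrix_mulVec]
      rw [follow_down i j.val (by omega)]
      split_ifs <;> simp [passage_inj, isUnit_T]
    · simp only [of_apply, hentry, rowIndex, columnIndex, pretzelKnot_alexanderMatrix_mulVec]
      have hne : follow k c false ≠ passage k c false := by
        rw [hup]
        split_ifs <;> simp [passage_inj, crossing_ext_iff]
        omega
      split_ifs <;> simp [passage_inj, hne, isUnit_T]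
  · intro a b hab hr
    have hzero : ∀ (c : PretzelCrossing k) (d : Bool),
        follow k c d ≠ columnIndex (.inl b) → passage k c d ≠ columnIndex (.inl b) →
        passage k c (!d) ≠ columnIndex (.inl b) →
        ((pretzelKnot k).alexanderMatrix *ᵥ Pi.single (columnIndex (.inl b)) 1) (passage k c d)
          = 0 := by
      intro c d h1 h2 h3
      rw [pretzelKnot_alexanderMatrix_mulVec]
      simp [h1, h2, h3]
    rw [of_apply, hentry]
    obtain ⟨i, j⟩ | c := a
    · refine hzero _ true ?_ ?_ ?_
      · rw [follow_down i j.val (by omega)]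
        rcases b with ⟨i', j'⟩ | c'
        · simp only [columnIndex, ne_eq, passage_inj, crossing_ext_iff, and_true]
          rintro ⟨rfl, h⟩
          exact hab (by simp only [Nat.add_right_cancel_iff] at h; simp [Fin.ext h])
        · simp [columnIndex, passage_inj]
      all_goals
        rcases b with ⟨i', j'⟩ | c' <;>
          simp only [columnIndex, ne_eq, passage_inj, crossing_ext_iff, and_true, and_false,
            reduceCtorEq, not_false_eq_true, Bool.not_true] <;>
          simp only [eliminationRank] at hr <;> omega
    · refine hzero _ false ?_ ?_ ?_
      · rw [hup]
        split_ifs <;> rcases b with ⟨i', j'⟩ | c' <;>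
          simp only [columnIndex, ne_eq, passage_inj, crossing_ext_iff, and_true, and_false, top,
            reduceCtorEq, not_false_eq_true] <;>
          simp only [eliminationRank] at hr <;> omega
      · rcases b with ⟨i', j'⟩ | c' <;>
          simp only [columnIndex, ne_eq, passage_inj, and_true, and_false, reduceCtorEq,
            not_false_eq_true]
        rintro rfl
        exact hab rfl
      · rcases b with ⟨i', j'⟩ | c' <;>
          simp only [columnIndex, ne_eq, passage_inj, crossing_ext_iff, and_true, and_false,
            reduceCtorEq, not_false_eq_true, Bool.not_false] <;>
          simp only [eliminationRank] at hr <;> omega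

end PretzelCrossing

theorem pretzelKnot_alexanderIdeal {g : ℕ} (k : Fin (2 * g + 1) → ℤ) :
    (pretzelKnot k).alexanderIdeal =
      (cyclicBidiagonal (fun i => (k i : ℤ[T;T⁻¹]) * (T (-1) - 1) + T (-1))
        (fun i => (k i : ℤ[T;T⁻¹]) * (T (-1) - 1) - 1) *
          cyclicDifference ℤ[T;T⁻¹] (2 * g + 1)).cofactorIdeal := by
  set x : Fin (2 * g + 1) → Fin (2 * g + 1) → ℤ[T;T⁻¹] :=
    fun b i => (Pi.single i 1 : Fin (2 * g + 1) → ℤ[T;T⁻¹]) b with hx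
  set V : Matrix (PretzelCrossing k × Bool) (Fin (2 * g + 1)) ℤ[T;T⁻¹] :=
    of fun p b => colour (T (-1)) (x b) p with hV
  have hMV : ∀ p b, ((pretzelKnot k).alexanderMatrix * V) p b =
      ((pretzelKnot k).alexanderMatrix *ᵥ colour (T (-1)) (x b)) p := fun p b => rfl
  rw [alexanderIdeal_eq, cofactorIdeal_eliminate _ (Equiv.ofBijective _ rowIndex_bijective)
    (Equiv.ofBijective _ columnIndex_bijective) V]
  -- The remaining rows agree with those of the product up to the unit factors from `colour_bottom`.
  · have hu : IsUnit (diagonal fun i => (if 0 ≤ k i then T 1 else -1 : ℤ[T;T⁻¹])).det := by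
      rw [det_diagonal]
      refine IsUnit.prod_iff.2 fun i _ => ?_
      split_ifs
      · exact isUnit_T 1
      · exact isUnit_one.neg
    refine Eq.trans (congrArg _ ?_) (cofactorIdeal_isUnit_mul hu _)
    ext1 i b
    rw [diagonal_mul, of_apply, hMV]
    change (_ *ᵥ _) (passage k (bottom k i) true) = _
    rw [colour_bottom]
    congr 1
    rw [mul_apply]
    simp only [cyclicBidiagonal_apply, sub_mul, ite_mul, zero_mul, Finset.sum_sub_distrib,
      Finset.sum_ite_eq', Finset.mem_univ, if_true, hx, Pi.single_apply, Pi.one_apply]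
  · intro b
    ext1 b'
    change colour _ _ (passage k (top k b) true) = _
    rw [colour_top]
  · rintro (⟨i, j⟩ | c) <;> ext1 b
    · exact (hMV _ b).trans (colour_relation (x b) _ true fun _ => by dsimp only; omega)
    · exact (hMV _ b).trans (colour_relation (x b) _ false (by simp))
  · exact isUnit_det_eliminated k

theorem pretzelKnot_isConwayPolynomial {g : ℕ} (k : Fin (2 * g + 1) → ℤ) :
    (pretzelKnot k).IsConwayPolynomial (pretzelConway k) := by
  have hT : ∀ n : ℤ, (T n * T (-n) : ℤ[T;T⁻¹]) = 1 := fun n => by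
    rw [← T_add, add_neg_cancel, T_zero]
  have hone : ∀ n : ℤ, (1 + T n : ℤ[T;T⁻¹]) ≠ 0 := by
    intro n h
    have := congrArg evalOneHom h
    simp at this
  obtain ⟨Q, hQ⟩ := pretzelConway.exists_expand k
  -- The Conway polynomial is `Q(z²)` and `z² = t - 2 + t⁻¹`. In this form the symmetry of `Δ` is
  -- visible, and `Δ(1) = Q(0)` is the constant coefficient.
  set Δ : ℤ[T;T⁻¹] := Polynomial.aeval (T 1 - 2 + T (-1) : ℤ[T;T⁻¹]) Q with hΔ
  have hsub : Polynomial.aeval (T 1 - T (-1) : ℤ[T;T⁻¹]) (pretzelConway k) = substPow 2 Δ := by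
    rw [← substPowHom_apply, hΔ, ← hQ, Polynomial.expand_aeval, Polynomial.map_aeval_int]
    congr 2
    simp only [map_add, map_sub, substPowHom_T, map_ofNat]
    have h1 : (T (2 * 1) : ℤ[T;T⁻¹]) = T 1 * T 1 := (T_add 1 1)
    have h2 : (T (2 * -1) : ℤ[T;T⁻¹]) = T (-1) * T (-1) := by
      rw [← T_add]; rfl
    rw [h1, h2]
    linear_combination (-2 : ℤ[T;T⁻¹]) * hT 1
  obtain ⟨c, hc, hyc⟩ := exists_cofactorIdeal_cyclic
    (fun i => (k i : ℤ[T;T⁻¹]) * (T (-1) - 1) + T (-1))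
    (fun i => (k i : ℤ[T;T⁻¹]) * (T (-1) - 1) - 1) (1 + T (-1)) (hone _) (fun i => by ring)
  -- Compared after the injective substitution `t ↦ t²`. Taking `-T (-1)` out of every factor turns
  -- the factors `a` into those with `-y` and the factors `b` into those with `x`; the sign of the
  -- odd power restores the order of the difference.
  have hcΔ : c = T (-g) * Δ := by
    apply substPowHom_injective (two_ne_zero : (2 : ℤ) ≠ 0)
    have h1 := congrArg (substPowHom 2) hyc
    have h2 := pretzelConway.add_mul_aeval k (hT 1)
    rw [hsub, ← substPowHom_apply] at h2
    simp only [map_mul, map_sub, map_add, map_prod, map_one, map_intCast, substPowHom_T] at h1 ⊢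
    have e2 : (T (2 * -1) : ℤ[T;T⁻¹]) = T (-1) * T (-1) := by
      rw [← T_add]; rfl
    have e3 : (T (2 * -(g : ℤ)) : ℤ[T;T⁻¹]) = T (-1) ^ (2 * g) := by
      rw [T_pow]; congr 1; push_cast; ring
    have ha : ∏ i, ((k i : ℤ[T;T⁻¹]) * (T (2 * -1) - 1) + T (2 * -1)) =
        -(T (-1)) ^ (2 * g + 1) * ∏ i, ((k i : ℤ[T;T⁻¹]) * (T 1 - T (-1)) - T (-1)) := by
      have : ∀ i, (k i : ℤ[T;T⁻¹]) * (T (2 * -1) - 1) + T (2 * -1) =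
          -T (-1) * ((k i : ℤ[T;T⁻¹]) * (T 1 - T (-1)) - T (-1)) := fun i => by
        rw [e2]; linear_combination (k i : ℤ[T;T⁻¹]) * (hT 1)
      rw [Finset.prod_congr rfl fun i _ => this i, Finset.prod_mul_distrib, Finset.prod_const,
        Finset.card_univ, Fintype.card_fin, Odd.neg_pow ⟨g, rfl⟩]
    have hb : ∏ i, ((k i : ℤ[T;T⁻¹]) * (T (2 * -1) - 1) - 1) =
        -(T (-1)) ^ (2 * g + 1) * ∏ i, ((k i : ℤ[T;T⁻¹]) * (T 1 - T (-1)) + T 1) := by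
      have : ∀ i, (k i : ℤ[T;T⁻¹]) * (T (2 * -1) - 1) - 1 =
          -T (-1) * ((k i : ℤ[T;T⁻¹]) * (T 1 - T (-1)) + T 1) := fun i => by
        rw [e2]; linear_combination ((k i : ℤ[T;T⁻¹]) + 1) * (hT 1)
      rw [Finset.prod_congr rfl fun i _ => this i, Finset.prod_mul_distrib, Finset.prod_const,
        Finset.card_univ, Fintype.card_fin, Odd.neg_pow ⟨g, rfl⟩]
    rw [ha, hb] at h1
    refine mul_left_cancel₀ (hone (2 * -1)) ?_
    rw [h1, e3, e2]
    linear_combination T (-1) ^ (2 * g + 1) * (-h2) + T (-1) ^ (2 * g) * substPowHom 2 Δ * hT 1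
  refine ⟨Δ, ⟨?_, ?_, ?_⟩, hsub⟩
  · rw [pretzelKnot_alexanderIdeal, hc, hcΔ]
    exact Ideal.span_singleton_mul_left_unit (isUnit_T _) _
  · have : invert Δ = Polynomial.aeval (invert (T 1 - 2 + T (-1) : ℤ[T;T⁻¹])) Q :=
      Polynomial.map_aeval_int (invert (R := ℤ)).toAlgHom.toRingHom _ Q
    rw [this, hΔ]
    congr 2
    simp only [map_add, map_sub, invert_T, map_ofNat, neg_neg]
    ring
  · rw [← evalOneHom_apply, hΔ, Polynomial.map_aeval_int]
    simp only [map_add, map_sub, evalOneHom_T, map_ofNat]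
    have := pretzelConway.coeff_zero k
    rw [← hQ, Polynomial.coeff_zero_eq_eval_zero, Polynomial.expand_eval] at this
    simpa [Polynomial.coe_aeval_eq_eval] using this

/-! ### The circles of a state of a pretzel diagram -/

namespace PretzelCrossing

section Cyclic

variable {m : ℕ} [NeZero m] (z : Fin m → Prop)

/-- The arcs `(i, true)` at the top and `(i, false)` at the bottom of a pretzel diagram run into
the column `i` from the left.  They are joined along the column `i` if it is smoothed to two
vertical strands (`z i`), and otherwise to the arcs on the other side of the column. -/
inductive ArcJoined : Fin m × Bool → Fin m × Bool → Prop
  | vertical (i : Fin m) (h : z i) : ArcJoined (i, true) (i, false)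
  | vertical_right (i : Fin m) (h : z i) : ArcJoined (i + 1, true) (i + 1, false)
  | horizontal (i : Fin m) (s : Bool) (h : ¬ z i) : ArcJoined (i, s) (i + 1, s)

variable {z}

theorem card_arcs_of_forall_not (h : ∀ i, ¬ z i) : Nat.card (Quot (ArcJoined z)) = 2 := by
  have e : Quot (ArcJoined z) ≃ Bool :=
    { toFun := Quot.lift Prod.snd (by rintro _ _ (⟨i, hi⟩ | ⟨i, hi⟩ | ⟨i, s, hi⟩) <;>
        first | rfl | exact absurd hi (h i))
      invFun := fun s => Quot.mk _ (0, s)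
      left_inv := by
        rintro ⟨i, s⟩
        change Quot.mk _ (0, s) = Quot.mk _ (i, s)
        induction i using column_induction with
        | h0 => rfl
        | h i ih => exact ih.trans (Quot.sound (.horizontal i s (h i)))
      right_inv := fun s => rfl }
  rw [Nat.card_congr e, Nat.card_eq_fintype_card, Fintype.card_bool]

open Fin.CommRing in
theorem exists_add_natCast (h : ∃ i, z i) (i : Fin m) : ∃ s : ℕ, z (i + (s : Fin m)) := by
  obtain ⟨r, hr⟩ := h
  exact ⟨(r - i).val, by rwa [Fin.cast_val_eq_self, add_sub_cancel]⟩

open Classical in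
/-- The number of columns to pass until the next column that satisfies `z`. -/
noncomputable def distNext (h : ∃ i, z i) (i : Fin m) : ℕ := Nat.find (exists_add_natCast h i)

open Fin.CommRing in
/-- The next column that satisfies `z`. -/
noncomputable def nextColumn (h : ∃ i, z i) (i : Fin m) : Fin m := i + (distNext h i : Fin m)

theorem nextColumn_spec (h : ∃ i, z i) (i : Fin m) : z (nextColumn h i) := by
  classical exact Nat.find_spec (exists_add_natCast h i)

open Fin.CommRing in
theorem distNext_eq_zero (h : ∃ i, z i) {i : Fin m} : distNext h i = 0 ↔ z i := by
  classical rw [distNext, Nat.find_eq_zero, Nat.cast_zero, add_zero]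

open Fin.CommRing in
theorem nextColumn_self (h : ∃ i, z i) {i : Fin m} (hi : z i) : nextColumn h i = i := by
  rw [nextColumn, (distNext_eq_zero h).2 hi, Nat.cast_zero, add_zero]

open Fin.CommRing in
theorem distNext_succ (h : ∃ i, z i) {i : Fin m} (hi : ¬ z i) :
    distNext h i = distNext h (i + 1) + 1 := by
  classical
  have h2 : ∃ s : ℕ, z (i + ((s + 1 : ℕ) : Fin m)) := by
    obtain ⟨s, hs⟩ := exists_add_natCast h (i + 1)
    exact ⟨s, by rwa [Nat.cast_add, Nat.cast_one, add_comm (s : Fin m), ← add_assoc]⟩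
  rw [distNext, Nat.find_comp_succ _ h2 (by rwa [Nat.cast_zero, add_zero]), distNext]
  congr 1
  refine Nat.find_congr' fun {s} => ?_
  rw [Nat.cast_add, Nat.cast_one, add_comm (s : Fin m), ← add_assoc]

open Fin.CommRing in
theorem nextColumn_succ (h : ∃ i, z i) {i : Fin m} (hi : ¬ z i) :
    nextColumn h (i + 1) = nextColumn h i := by
  rw [nextColumn, nextColumn, distNext_succ h hi, Nat.cast_add, Nat.cast_one]
  abel

theorem mk_nextColumn (h : ∃ i, z i) (i : Fin m) (s : Bool) :
    (Quot.mk _ (nextColumn h i, s) : Quot (ArcJoined z)) = Quot.mk _ (i, s) := by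
  generalize hn : distNext h i = n
  induction n generalizing i with
  | zero => rw [nextColumn_self h ((distNext_eq_zero h).1 hn)]
  | succ n ih =>
    have hi : ¬ z i := fun hi => by
      rw [(distNext_eq_zero h).2 hi] at hn
      omega
    rw [distNext_succ h hi, Nat.add_right_cancel_iff] at hn
    rw [← nextColumn_succ h hi, ih _ hn]
    exact (Quot.sound (.horizontal i s hi)).symm

/-- An arc can be followed to the right, through cut columns, up to the first uncut column at which
it arrives. The top and the bottom arc arriving there are joined along its left strand, so that
column names the circle. -/
theorem card_arcs_of_exists (h : ∃ i, z i) :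
    Nat.card (Quot (ArcJoined z)) = Nat.card {i // z i} := by
  refine Nat.card_congr
    { toFun := Quot.lift (fun x => ⟨nextColumn h x.1, nextColumn_spec h x.1⟩) ?_
      invFun := fun r => Quot.mk _ (r.1, true)
      left_inv := ?_
      right_inv := fun r => Subtype.ext (nextColumn_self h r.2) }
  · rintro _ _ (⟨i, hi⟩ | ⟨i, hi⟩ | ⟨i, s, hi⟩)
    · rfl
    · rfl
    · exact Subtype.ext (nextColumn_succ h hi).symm
  · rintro ⟨i, s⟩
    change Quot.mk _ (nextColumn h i, true) = Quot.mk _ (i, s)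
    rw [← mk_nextColumn h i s]
    cases s
    · exact Quot.sound (.vertical _ (nextColumn_spec h i))
    · rfl

end Cyclic

end PretzelCrossing

/-! ### Cuts of a state and gaps between half twists -/

namespace PretzelCrossing

variable {m : ℕ} {k : Fin m → ℤ}

theorem odd_height (i : Fin m) : Odd (2 * k i + 1).natAbs := Int.natAbs_odd.2 ⟨k i, rfl⟩

/-- Whether the half twist with the number `j` of the column `i` exists and is smoothed to two
horizontal strands. -/
def Cut (H : PretzelCrossing k → Prop) (i : Fin m) (j : ℕ) : Prop :=
  ∃ h : j < (2 * k i + 1).natAbs, H ⟨i, ⟨j, h⟩⟩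

open Classical in
/-- The number of half twists smoothed horizontally among the first `l` ones of a column. -/
noncomputable def cuts (H : PretzelCrossing k → Prop) (i : Fin m) (l : ℕ) : ℕ :=
  Nat.count (Cut H i) l

/-- The number of half twists of a column that are smoothed horizontally. -/
noncomputable def allCuts (H : PretzelCrossing k → Prop) (i : Fin m) : ℕ :=
  cuts H i (2 * k i + 1).natAbs

variable (H : PretzelCrossing k → Prop)

@[simp]
theorem cuts_zero (i : Fin m) : cuts H i 0 = 0 := by
  classical exact Nat.count_zero _

variable {H}

theorem cuts_succ_of_cut {c : PretzelCrossing k} (h : H c) :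
    cuts H c.1 (c.2.val + 1) = cuts H c.1 c.2.val + 1 := by
  classical
  have : Cut H c.1 c.2.val := ⟨c.2.2, h⟩
  rw [cuts, Nat.count_succ, if_pos this]
  rfl

theorem cuts_succ_of_not_cut {i : Fin m} {j : ℕ} (h : ¬ Cut H i j) :
    cuts H i (j + 1) = cuts H i j := by
  classical
  rw [cuts, Nat.count_succ, if_neg h]
  rfl

theorem cuts_mono (i : Fin m) {l l' : ℕ} (h : l ≤ l') : cuts H i l ≤ cuts H i l' := by
  classical exact Nat.count_monotone _ h

theorem cuts_lt_allCuts {c : PretzelCrossing k} (h : H c) : cuts H c.1 c.2.val < allCuts H c.1 := by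
  have := cuts_mono (H := H) c.1 (Nat.succ_le_of_lt c.2.2)
  rw [Nat.succ_eq_add_one, cuts_succ_of_cut h] at this
  exact this

/-- A discrete intermediate value theorem: the count starts at 0 and grows by at most one per half
twist. -/
theorem exists_cuts_eq (i : Fin m) {c : ℕ} (hc : c ≤ allCuts H i) :
    ∃ l ≤ (2 * k i + 1).natAbs, cuts H i l = c := by
  classical
  have : ∀ n, ∀ c ≤ cuts H i n, ∃ l ≤ n, cuts H i l = c := by
    intro n
    induction n with
    | zero =>
      intro c hc
      exact ⟨0, le_rfl, by simp at hc ⊢; omega⟩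
    | succ n ih =>
      intro c hc
      by_cases h : c ≤ cuts H i n
      · obtain ⟨l, hl, hl'⟩ := ih c h
        exact ⟨l, by omega, hl'⟩
      · refine ⟨n + 1, le_rfl, ?_⟩
        rw [cuts, Nat.count_succ] at hc ⊢
        change ¬ c ≤ Nat.count (Cut H i) n at h
        split_ifs at hc ⊢ <;> omega
  exact this _ c hc

variable [NeZero m]

/-- The edge of the column `i` that lies on the left-hand (`r = false`) or right-hand (`r = true`)
strand below the first `l` half twists. -/
def gapEdge (k : Fin m → ℤ) (i : Fin m) (l : ℕ) (r : Bool) : PretzelCrossing k × Bool :=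
  if r = decide (Odd l) then
    if h : l < (2 * k i + 1).natAbs then passage k ⟨i, ⟨l, h⟩⟩ true
    else passage k (bottom k (i + 1)) false
  else
    if h : 0 < l ∧ l ≤ (2 * k i + 1).natAbs then passage k ⟨i, ⟨l - 1, by omega⟩⟩ false
    else passage k (top k (i + 1)) true

theorem passage_eq_gapEdge (c : PretzelCrossing k) (d : Bool) :
    passage k c d =
      gapEdge k c.1 (if d then c.2.val else c.2.val + 1) (decide (Odd c.2.val)) := by
  obtain ⟨i, j, hj⟩ := c
  cases d
  · rw [gapEdge, if_neg, dif_pos]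
    · simp
    · simpa using hj
    · simp [Nat.odd_add_one, -Nat.not_odd_iff_even]
  · rw [gapEdge, if_pos (by simp), dif_pos (by simpa using hj)]
    simp

theorem follow_eq_gapEdge (c : PretzelCrossing k) (d : Bool) :
    follow k c d =
      gapEdge k c.1 (if d then c.2.val + 1 else c.2.val) (!decide (Odd c.2.val)) := by
  obtain ⟨i, j, hj⟩ := c
  cases d
  · rw [gapEdge, if_neg (by simp), follow]
    simp only [Bool.false_eq_true, if_false, hj.le, and_true]
    split_ifs <;> rfl
  · rw [gapEdge, if_pos, follow]
    · rfl
    · simp [Nat.odd_add_one, -Nat.not_odd_iff_even]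

/-- The arc at the top from one column to the next is a single edge with two names as a gap edge;
`gapEdge_height` is the same at the bottom. -/
theorem gapEdge_zero (i : Fin m) : gapEdge k i 0 true = gapEdge k (i + 1) 0 false := by
  simp only [gapEdge]
  rw [if_neg (by simp), dif_neg (by simp), if_pos (by simp), dif_pos]
  · rfl

theorem gapEdge_height (i : Fin m) :
    gapEdge k i (2 * k i + 1).natAbs true =
      gapEdge k (i + 1) (2 * k (i + 1) + 1).natAbs false := by
  have h := odd_height (k := k) (i + 1)
  have h0 := h.pos
  simp only [gapEdge]
  rw [if_pos (by simp), dif_neg (by simp), if_neg (by simp [h]), dif_pos ⟨h0, le_rfl⟩]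
  rfl

/-- The functions on the edges that are constant on the circles of a state. -/
structure GapRelation (H : PretzelCrossing k → Prop) {X : Type*}
    (f : PretzelCrossing k × Bool → X) : Prop where
  vertical : ∀ c r, ¬ H c → f (gapEdge k c.1 c.2.val r) = f (gapEdge k c.1 (c.2.val + 1) r)
  above : ∀ c, H c → f (gapEdge k c.1 c.2.val true) = f (gapEdge k c.1 c.2.val false)
  below : ∀ c, H c → f (gapEdge k c.1 (c.2.val + 1) true) = f (gapEdge k c.1 (c.2.val + 1) false)

/-- As the strands are antiparallel, both incoming edges of a half twist lie on one side and both
outgoing ones on the other. So the smoothing that joins incoming to incoming is the vertical one,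
and the oriented smoothing is the cut. -/
theorem gapRelation_iff {X : Type*} (f : PretzelCrossing k × Bool → X) :
    GapRelation H f ↔ (∀ c d, H c → f (passage k c d) = f (follow k c !d)) ∧
      (∀ c, ¬ H c → f (passage k c true) = f (passage k c false)) ∧
      ∀ c, ¬ H c → f (follow k c true) = f (follow k c false) := by
  simp only [passage_eq_gapEdge, follow_eq_gapEdge]
  constructor
  · rintro ⟨h1, h2, h3⟩
    refine ⟨fun c d hc => ?_, fun c hc => h1 c _ hc, fun c hc => (h1 c _ hc).symm⟩
    have h2 := h2 c hc
    have h3 := h3 c hc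
    cases d <;> cases decide (Odd c.2.val) <;> simp [h2, h3]
  · rintro ⟨h1, h2, h3⟩
    refine ⟨fun c r hc => ?_, fun c hc => ?_, fun c hc => ?_⟩
    · have h2 := h2 c hc
      have h3 := h3 c hc
      revert h2 h3
      cases r <;> cases decide (Odd c.2.val) <;> simp +contextual
    · have h1 := h1 c true hc
      revert h1
      cases decide (Odd c.2.val) <;> simp +contextual
    · have h1 := h1 c false hc
      revert h1
      cases decide (Odd c.2.val) <;> simp +contextual

/-- The half twists that a state smooths to two horizontal strands. -/
def IsCut (k : Fin m → ℤ) (σ : PretzelCrossing k → Bool) (c : PretzelCrossing k) : Prop :=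
  σ c = true ↔ ¬ 0 ≤ k c.1

/-- Quantifying over all functions `f` compares the generated equivalences without matching the
generating pairs. Right-handed twists are negative crossings, where the oriented smoothing is the
`B`-smoothing, in accordance with `IsCut`. -/
theorem joined_iff {g : ℕ} {k : Fin (2 * g + 1) → ℤ} (σ : PretzelCrossing k → Bool) {X : Type*}
    (f : PretzelCrossing k × Bool → X) :
    (∀ x y, (pretzelKnot k).Joined σ x y → f x = f y) ↔ GapRelation (IsCut k σ) f := by
  have hsign : ∀ c, (σ c = true ↔ (pretzelKnot k).sign c = 1) ↔ IsCut k σ c := by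
    intro c
    change (_ ↔ (if 0 ≤ k c.1 then (-1 : ℤˣ) else 1) = 1) ↔ _
    rw [IsCut]
    by_cases h : 0 ≤ k c.1 <;> simp [h]
  have hnext : ∀ c d, (pretzelKnot k).next (passage k c d) = follow k c d := next_passage k
  have hpair : ∀ c, (passage k c true = (c, true) ∧ passage k c false = (c, false)) ∨
      (passage k c true = (c, false) ∧ passage k c false = (c, true)) := by
    intro c
    simp only [passage]
    cases decide (Odd c.2.val) <;> cases decide (0 ≤ k c.1) <;> simp
  rw [gapRelation_iff]
  constructor
  · intro h
    refine ⟨fun c d hc => ?_, fun c hc => ?_, fun c hc => ?_⟩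
    · rw [← hnext]
      have h1 := h _ _ (.oriented c true ((hsign c).2 hc))
      have h2 := h _ _ (.oriented c false ((hsign c).2 hc))
      obtain ⟨e1, e2⟩ | ⟨e1, e2⟩ := hpair c <;> cases d <;> simpa [e1, e2] using by assumption
    · have h1 := h _ _ (.incoming c (fun h => hc ((hsign c).1 h)))
      obtain ⟨e1, e2⟩ | ⟨e1, e2⟩ := hpair c <;> rw [e1, e2, h1]
    · have h1 := h _ _ (.outgoing c (fun h => hc ((hsign c).1 h)))
      rw [← hnext, ← hnext]
      obtain ⟨e1, e2⟩ | ⟨e1, e2⟩ := hpair c <;> rw [e1, e2, h1]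
  · rintro ⟨h1, h2, h3⟩ _ _ (⟨c, b, hc⟩ | ⟨c, hc⟩ | ⟨c, hc⟩)
    · rw [← passage_descends k (c, b)]
      have h1 := h1 c (descends k (c, b)) ((hsign c).1 hc)
      rw [← hnext] at h1
      rw [h1]
      congr 2
      obtain ⟨e1, e2⟩ | ⟨e1, e2⟩ := hpair c <;> cases b <;>
        first
        | rw [← e1, descends_passage]; exact e2
        | rw [← e2, descends_passage]; exact e1
    · have h2 := h2 c (fun h => hc ((hsign c).2 h))
      obtain ⟨e1, e2⟩ | ⟨e1, e2⟩ := hpair c <;> rw [← e1, ← e2, h2]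
    · have h3 := h3 c (fun h => hc ((hsign c).2 h))
      rw [← hnext, ← hnext] at h3
      obtain ⟨e1, e2⟩ | ⟨e1, e2⟩ := hpair c <;> rw [← e1, ← e2, h3]

end PretzelCrossing

/-! ### Names for the circles of a state -/

namespace PretzelCrossing

variable {m : ℕ} [NeZero m] {k : Fin m → ℤ} {H : PretzelCrossing k → Prop}

namespace GapRelation

variable {X : Type*} {f : PretzelCrossing k × Bool → X}

theorem eq_of_cuts_eq (hf : GapRelation H f) (i : Fin m) (r : Bool) {l l' : ℕ} (h : l ≤ l')
    (h' : l' ≤ (2 * k i + 1).natAbs) (he : cuts H i l = cuts H i l') :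
    f (gapEdge k i l r) = f (gapEdge k i l' r) := by
  induction l', h using Nat.le_induction with
  | base => rfl
  | succ n hn ih =>
    have h1 := cuts_mono (H := H) i hn
    have h2 := cuts_mono (H := H) i (Nat.le_succ n)
    by_cases hc : H ⟨i, ⟨n, h'⟩⟩
    · have := cuts_succ_of_cut hc
      simp only at this
      omega
    · rw [ih (by omega) (by rw [Nat.succ_eq_add_one] at h2; omega)]
      exact hf.vertical ⟨i, ⟨n, h'⟩⟩ r hc

/-- The last cut above the gap joins the two strands just below it, and the uncut half twists carry
both down to the gap. `eq_of_cuts_lt` is the mirror image with the next cut below. -/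
theorem eq_of_cuts_pos (hf : GapRelation H f) (i : Fin m) {l : ℕ}
    (h : l ≤ (2 * k i + 1).natAbs) (hp : 0 < cuts H i l) :
    f (gapEdge k i l true) = f (gapEdge k i l false) := by
  induction l with
  | zero => simp at hp
  | succ l ih =>
    by_cases hc : H ⟨i, ⟨l, h⟩⟩
    · exact hf.below ⟨i, ⟨l, h⟩⟩ hc
    · have hc' : ¬ Cut H i l := fun ⟨_, h⟩ => hc h
      rw [cuts_succ_of_not_cut hc'] at hp
      have hv := fun r => hf.vertical ⟨i, ⟨l, h⟩⟩ r hc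
      simp only at hv
      rw [← hv, ← hv, ih (by omega) hp]

theorem eq_of_cuts_lt (hf : GapRelation H f) (i : Fin m) {l : ℕ}
    (h : l ≤ (2 * k i + 1).natAbs) (hp : cuts H i l < allCuts H i) :
    f (gapEdge k i l true) = f (gapEdge k i l false) := by
  induction h using Nat.decreasingInduction with
  | self => exact absurd hp (lt_irrefl _)
  | of_succ l h ih =>
    by_cases hc : H ⟨i, ⟨l, h⟩⟩
    · exact hf.above ⟨i, ⟨l, h⟩⟩ hc
    · have hc' : ¬ Cut H i l := fun ⟨_, h⟩ => hc h
      rw [← cuts_succ_of_not_cut hc'] at hp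
      have hv := fun r => hf.vertical ⟨i, ⟨l, h⟩⟩ r hc
      simp only at hv
      rw [hv, hv, ih hp]

end GapRelation

/-- The names of the circles of a state: the circles inside the columns, each of which lies between
two consecutive cuts, and the other ones, which contain arcs at the top or at the bottom. -/
abbrev CircleName (H : PretzelCrossing k → Prop) : Type :=
  ((i : Fin m) × Fin (allCuts H i - 1)) ⊕ Quot (ArcJoined fun i => allCuts H i = 0)

/-- The circle on the left-hand (`r = false`) or right-hand (`r = true`) side of the gap above the
half twist with the number `l` of the column `i`. -/
noncomputable def gapName (H : PretzelCrossing k → Prop) (i : Fin m) (l : ℕ) (r : Bool) :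
    CircleName H :=
  if h : 0 < cuts H i l ∧ cuts H i l < allCuts H i then .inl ⟨i, ⟨cuts H i l - 1, by omega⟩⟩
  else .inr (Quot.mk _ (if r then i + 1 else i, decide (cuts H i l = 0)))

/-- The circle through an edge. -/
noncomputable def edgeName (H : PretzelCrossing k → Prop) (p : PretzelCrossing k × Bool) :
    CircleName H :=
  gapName H p.1.1 (if descends k p then p.1.2.val else p.1.2.val + 1) (decide (Odd p.1.2.val))

theorem edgeName_passage (c : PretzelCrossing k) (d : Bool) :
    edgeName H (passage k c d) =
      gapName H c.1 (if d then c.2.val else c.2.val + 1) (decide (Odd c.2.val)) := by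
  rw [edgeName, descends_passage]
  rfl

theorem gapName_zero (i : Fin m) (r : Bool) :
    gapName H i 0 r = .inr (Quot.mk _ (if r then i + 1 else i, true)) := by
  rw [gapName, dif_neg (by simp)]
  simp

theorem gapName_height (i : Fin m) (r : Bool) :
    gapName H i (2 * k i + 1).natAbs r = .inr (Quot.mk _ (if r then i + 1 else i, false)) := by
  rw [gapName, dif_neg (by simp [allCuts])]
  -- In a column without cuts `gapName` always gives the top arc; the vertical strands identify it
  -- with the bottom arc.
  by_cases h : cuts H i (2 * k i + 1).natAbs = 0
  · rw [decide_eq_true h]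
    congr 1
    cases r
    · exact Quot.sound (.vertical i h)
    · exact Quot.sound (.vertical_right i h)
  · rw [decide_eq_false h]

theorem edgeName_gapEdge (i : Fin m) {l : ℕ} (h : l ≤ (2 * k i + 1).natAbs) (r : Bool) :
    edgeName H (gapEdge k i l r) = gapName H i l r := by
  rw [gapEdge]
  split_ifs with h1 h2 h2
  · rw [edgeName_passage, h1]
    rfl
  · obtain rfl : l = (2 * k i + 1).natAbs := by omega
    rw [edgeName_passage, if_neg (by decide), bottom_val_add_one,
      decide_eq_false (not_odd_bottom _), h1, gapName_height, decide_eq_true (odd_height i)]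
    exact gapName_height _ _
  · rw [edgeName_passage]
    have : decide (Odd (l - 1)) = r := by
      obtain ⟨l, rfl⟩ := Nat.exists_eq_add_one.2 h2.1
      rw [Nat.add_sub_cancel]
      simp only [Nat.odd_add_one] at h1
      revert h1
      by_cases ho : Odd l <;> cases r <;> simp [ho]
    simp only [this, Bool.false_eq_true, if_false, Nat.sub_add_cancel h2.1]
  · obtain rfl : l = 0 := by omega
    have : r = true := by simpa using h1
    subst this
    rw [edgeName_passage, gapName_zero]
    exact gapName_zero _ _

theorem gapRelation_edgeName : GapRelation H (edgeName H) := by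
  refine ⟨fun c r h => ?_, fun c h => ?_, fun c h => ?_⟩
  · have hc' : ¬ Cut H c.1 c.2.val := fun ⟨_, h'⟩ => h h'
    rw [edgeName_gapEdge _ c.2.2.le, edgeName_gapEdge _ c.2.2]
    simp only [gapName, cuts_succ_of_not_cut hc']
  · have := cuts_lt_allCuts h
    rw [edgeName_gapEdge _ c.2.2.le, edgeName_gapEdge _ c.2.2.le, gapName, gapName]
    by_cases h1 : 0 < cuts H c.1 c.2.val ∧ cuts H c.1 c.2.val < allCuts H c.1
    · rw [dif_pos h1, dif_pos h1]
    · rw [dif_neg h1, dif_neg h1]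
      congr 1
      exact (Quot.sound (.horizontal c.1 _ (by omega))).symm
  · have := cuts_lt_allCuts h
    have h2 := cuts_succ_of_cut h
    rw [edgeName_gapEdge _ c.2.2, edgeName_gapEdge _ c.2.2, gapName, gapName]
    by_cases h1 : 0 < cuts H c.1 (c.2.val + 1) ∧ cuts H c.1 (c.2.val + 1) < allCuts H c.1
    · rw [dif_pos h1, dif_pos h1]
    · rw [dif_neg h1, dif_neg h1]
      congr 1
      exact (Quot.sound (.horizontal c.1 _ (by omega))).symm

/-- The number of classes of edges is the number of names. -/
theorem card_quot_eq {r : PretzelCrossing k × Bool → PretzelCrossing k × Bool → Prop}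
    (hr : GapRelation H (Quot.mk r)) (hn : ∀ x y, r x y → edgeName H x = edgeName H y) :
    Nat.card (Quot r) = Nat.card (CircleName H) := by
  -- For each circle inside a column, a gap between the two consecutive cuts that bound it.
  choose level hlevel using fun (x : (i : Fin m) × Fin (allCuts H i - 1)) =>
    exists_cuts_eq (H := H) x.1 (c := x.2.val + 1) (by omega)
  have hv : ∀ i s, allCuts H i = 0 → Quot.mk r (gapEdge k i 0 s) =
      Quot.mk r (gapEdge k i (2 * k i + 1).natAbs s) := by
    intro i s h
    exact hr.eq_of_cuts_eq i s (Nat.zero_le _) le_rfl (by rw [cuts_zero]; exact h.symm)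
  -- The inverse map sends a name to the class of an edge on that circle. It respects `ArcJoined`:
  -- vertical strands of uncut columns join top and bottom, while a cut column joins its two ends at
  -- the top and at the bottom.
  obtain ⟨F, hF, hF'⟩ : ∃ F : CircleName H → Quot r,
      (∀ x, F (.inl x) = Quot.mk r (gapEdge k x.1 (level x) false)) ∧
        ∀ i s, F (.inr (Quot.mk _ (i, s))) =
          Quot.mk r (gapEdge k i (if s then 0 else (2 * k i + 1).natAbs) false) := by
    refine ⟨Sum.elim (fun x => Quot.mk r (gapEdge k x.1 (level x) false))
      (Quot.lift (fun x => Quot.mk r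
        (gapEdge k x.1 (if x.2 then 0 else (2 * k x.1 + 1).natAbs) false)) ?_),
      fun _ => rfl, fun _ _ => rfl⟩
    rintro _ _ (⟨i, hi⟩ | ⟨i, hi⟩ | ⟨i, s, hi⟩)
    · exact hv i false hi
    · change Quot.mk r (gapEdge k (i + 1) 0 false) =
        Quot.mk r (gapEdge k (i + 1) (2 * k (i + 1) + 1).natAbs false)
      rw [← gapEdge_zero, ← gapEdge_height]
      exact hv i true hi
    · cases s
      · change Quot.mk r (gapEdge k i _ false) = Quot.mk r (gapEdge k (i + 1) _ false)
        simp only [Bool.false_eq_true, if_false]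
        rw [← gapEdge_height]
        exact (hr.eq_of_cuts_pos i le_rfl (Nat.pos_of_ne_zero hi)).symm
      · change Quot.mk r (gapEdge k i 0 false) = Quot.mk r (gapEdge k (i + 1) 0 false)
        rw [← gapEdge_zero]
        exact (hr.eq_of_cuts_lt i (Nat.zero_le _)
          (by rw [cuts_zero]; exact Nat.pos_of_ne_zero hi)).symm
  have key : ∀ i l s, l ≤ (2 * k i + 1).natAbs →
      F (gapName H i l s) = Quot.mk r (gapEdge k i l s) := by
    intro i l s hl
    have hle : cuts H i l ≤ allCuts H i := cuts_mono i hl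
    rw [gapName]
    by_cases h1 : 0 < cuts H i l ∧ cuts H i l < allCuts H i
    · rw [dif_pos h1, hF]
      generalize hx : (⟨i, ⟨cuts H i l - 1, by omega⟩⟩ :
        (i : Fin m) × Fin (allCuts H i - 1)) = x
      obtain ⟨h2, h3⟩ := hlevel x
      obtain rfl : i = x.1 := congrArg Sigma.fst hx
      have hx2 : x.2.val = cuts H x.1 l - 1 := by rw [← hx]
      have h4 : cuts H x.1 (level x) = cuts H x.1 l := by omega
      have h5 : Quot.mk r (gapEdge k x.1 (level x) false) = Quot.mk r (gapEdge k x.1 l false) := by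
        rcases le_total (level x) l with h | h
        · exact hr.eq_of_cuts_eq x.1 false h hl h4
        · exact (hr.eq_of_cuts_eq x.1 false h h2 h4.symm).symm
      refine h5.trans ?_
      cases s
      · rfl
      · exact (hr.eq_of_cuts_pos x.1 hl h1.1).symm
    · rw [dif_neg h1, hF']
      by_cases h0 : cuts H i l = 0
      · rw [← hr.eq_of_cuts_eq i s (Nat.zero_le l) hl (by rw [cuts_zero, h0]), decide_eq_true h0]
        cases s
        · rfl
        · exact congrArg _ (gapEdge_zero i).symm
      · rw [hr.eq_of_cuts_eq i s hl le_rfl (by change _ = allCuts H i; omega),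
          decide_eq_false h0]
        cases s
        · rfl
        · exact congrArg _ (gapEdge_height i).symm
  refine Nat.card_congr
    { toFun := Quot.lift (edgeName H) hn
      invFun := F
      left_inv := ?_
      right_inv := ?_ }
  · rintro ⟨p⟩
    rw [← passage_descends k p]
    change F (edgeName H _) = _
    rw [edgeName_passage, passage_eq_gapEdge]
    refine key _ _ _ ?_
    have := p.1.2.2
    split_ifs <;> omega
  · rintro (x | ⟨i, s⟩)
    · obtain ⟨h2, h3⟩ := hlevel x
      rw [hF]
      change edgeName H (gapEdge k x.1 (level x) false) = _
      rw [edgeName_gapEdge _ h2, gapName, dif_pos (by have := x.2.2; omega)]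
      simp only [h3, Nat.add_sub_cancel]
    · rw [hF']
      change edgeName H (gapEdge k i _ false) = _
      cases s
      · simp only [Bool.false_eq_true, if_false]
        rw [edgeName_gapEdge _ le_rfl, gapName_height]
        rfl
      · simp only [if_true]
        rw [edgeName_gapEdge _ (Nat.zero_le _), gapName_zero]
        rfl

end PretzelCrossing

/-! ### The Kauffman bracket of a pretzel diagram -/

section ColumnSum

variable {R : Type*} [CommRing R] (n : ℕ) (v : Bool) (e : Bool → R) (d : R)

/-- The number of half twists of a column where the state takes the value `v`. -/
def columnCuts {n : ℕ} (v : Bool) (τ : Fin n → Bool) : ℕ := (Finset.univ.filter (τ · = v)).card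

theorem columnCuts_eq_zero {n : ℕ} {v : Bool} {τ : Fin n → Bool} :
    columnCuts v τ = 0 ↔ τ = fun _ => !v := by
  rw [columnCuts, Finset.card_eq_zero, Finset.filter_eq_empty_iff, funext_iff]
  simp only [Finset.mem_univ, forall_const, Bool.eq_not]

/-- The sum over the states of a column with at least one cut. -/
def cutColumnSum : R :=
  ∑ τ : Fin n → Bool,
    if columnCuts v τ = 0 then 0 else (∏ j, e (τ j)) * d ^ (columnCuts v τ - 1)

theorem sum_uncut_column (f : (Fin n → Bool) → R) :
    (∑ τ : Fin n → Bool, if columnCuts v τ = 0 then f τ else 0) = f fun _ => !v := by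
  simp only [columnCuts_eq_zero]
  simp

/-- Expanding the power gives each state the weight `d` per cut. The uncut state is the separate
power, and the other states contain a factor `d` to take out, so no division is needed. -/
theorem mul_cutColumnSum_add :
    d * cutColumnSum n v e d + e (!v) ^ n = (e (!v) + d * e v) ^ n := by
  have h1 : (e (!v) + d * e v) ^ n =
      ∑ τ : Fin n → Bool, (∏ j, e (τ j)) * d ^ columnCuts v τ := by
    have : e (!v) + d * e v = ∑ b, e b * if b = v then d else 1 := by
      cases v <;> simp <;> ring
    rw [this]
    have := Finset.prod_univ_sum (fun _ : Fin n => (Finset.univ : Finset Bool))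
      fun _ b => e b * if b = v then d else 1
    rw [Fintype.piFinset_univ, Finset.prod_const, Finset.card_univ, Fintype.card_fin] at this
    rw [this]
    refine Finset.sum_congr rfl fun τ _ => ?_
    rw [Finset.prod_mul_distrib, Finset.prod_ite, Finset.prod_const, Finset.prod_const_one,
      mul_one]
    rfl
  have h2 : e (!v) ^ n =
      ∑ τ : Fin n → Bool, if columnCuts v τ = 0 then ∏ j, e (τ j) else 0 := by
    rw [sum_uncut_column]
    simp
  rw [h1, h2, cutColumnSum, Finset.mul_sum, ← Finset.sum_add_distrib]
  refine Finset.sum_congr rfl fun τ _ => ?_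
  split_ifs with h
  · rw [h, pow_zero, mul_one, mul_zero, zero_add]
  · obtain ⟨l, hl⟩ := Nat.exists_eq_succ_of_ne_zero h
    rw [hl, Nat.succ_sub_one, pow_succ]
    ring

theorem sum_column :
    ∑ τ : Fin n → Bool, (∏ j, e (τ j)) * d ^ (columnCuts v τ - 1) *
      (if columnCuts v τ = 0 then d else 1) = e (!v) ^ n * d + cutColumnSum n v e d := by
  have h2 : e (!v) ^ n * d =
      ∑ τ : Fin n → Bool, if columnCuts v τ = 0 then (∏ j, e (τ j)) * d else 0 := by
    rw [sum_uncut_column]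
    simp
  rw [h2, cutColumnSum, ← Finset.sum_add_distrib]
  refine Finset.sum_congr rfl fun τ _ => ?_
  split_ifs with h
  · rw [h]; ring
  · ring

end ColumnSum

theorem sum_states_prod {R : Type*} [CommRing R] {m : ℕ} (n : Fin m → ℕ)
    (F : ∀ i, (Fin (n i) → Bool) → R) :
    ∑ σ : ((i : Fin m) × Fin (n i)) → Bool, ∏ i, F i (fun j => σ ⟨i, j⟩) =
      ∏ i, ∑ τ, F i τ := by
  rw [Finset.prod_univ_sum, Fintype.piFinset_univ]
  exact Fintype.sum_equiv (Equiv.piCurry fun _ _ => Bool) _ _ fun σ => rfl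

namespace PretzelCrossing

theorem circles_eq {g : ℕ} {k : Fin (2 * g + 1) → ℤ} (σ : PretzelCrossing k → Bool) :
    (pretzelKnot k).circles σ = ∑ i, (allCuts (IsCut k σ) i - 1) +
      Nat.card (Quot (ArcJoined fun i => allCuts (IsCut k σ) i = 0)) := by
  have hr := (joined_iff σ (Quot.mk ((pretzelKnot k).Joined σ))).1 fun _ _ h => Quot.sound h
  have hn := (joined_iff σ _).2 (gapRelation_edgeName (H := IsCut k σ))
  rw [KnotDiagram.circles, card_quot_eq hr hn, Nat.card_sum, Nat.card_sigma]
  simp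

theorem allCuts_eq {m : ℕ} {k : Fin m → ℤ} (σ : PretzelCrossing k → Bool) (i : Fin m) :
    allCuts (IsCut k σ) i = columnCuts (!decide (0 ≤ k i)) fun j => σ ⟨i, j⟩ := by
  classical
  rw [allCuts, cuts, Nat.count_eq_card_filter_range, columnCuts]
  refine (Finset.card_bij (fun j _ => j.val) ?_ (fun _ _ _ _ => Fin.ext) ?_).symm
  · intro j hj
    rw [Finset.mem_filter] at hj ⊢
    refine ⟨Finset.mem_range.2 j.2, j.2, ?_⟩
    have := hj.2
    change σ ⟨i, j⟩ = true ↔ ¬ 0 ≤ k i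
    rw [this]
    simp
  · intro j hj
    rw [Finset.mem_filter] at hj
    obtain ⟨_, h, hc⟩ := hj
    refine ⟨⟨j, h⟩, Finset.mem_filter.2 ⟨Finset.mem_univ _, ?_⟩, rfl⟩
    change σ ⟨i, ⟨j, h⟩⟩ = true ↔ ¬ 0 ≤ k i at hc
    by_cases h0 : 0 ≤ k i
    · simpa [h0] using hc
    · simpa [h0] using hc

end PretzelCrossing

/-- The value of a circle in the Kauffman bracket. -/
noncomputable abbrev loopValue : ℤ[T;T⁻¹] := -T 2 - T (-2)

/-- The factor of a crossing in the Kauffman bracket. -/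
noncomputable def smoothingFactor (b : Bool) : ℤ[T;T⁻¹] := T (if b = true then 1 else -1)

/-- The sum of the states of a column with at least one horizontal smoothing. -/
noncomputable def columnBracket (κ : ℤ) : ℤ[T;T⁻¹] :=
  cutColumnSum (2 * κ + 1).natAbs (!decide (0 ≤ κ)) smoothingFactor loopValue

theorem smoothingFactor_pow (κ : ℤ) :
    smoothingFactor (!!decide (0 ≤ κ)) ^ (2 * κ + 1).natAbs = T (2 * κ + 1) := by
  rw [smoothingFactor, T_pow]
  congr 1
  by_cases h : 0 ≤ κ
  · simp only [h, decide_true, Bool.not_not, if_true]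
    omega
  · simp only [h, decide_false, Bool.not_not, Bool.false_eq_true, if_false]
    omega

/-- A cut with its extra circle plus the uncut smoothing gives `-A^(∓3)`, the factor of a kink under
the first Reidemeister move. The number of half twists is odd, so the sign survives. -/
theorem loopValue_mul_columnBracket (κ : ℤ) :
    loopValue * columnBracket κ + T (2 * κ + 1) = -T (-3 * (2 * κ + 1)) := by
  rw [← smoothingFactor_pow, columnBracket, mul_cutColumnSum_add]
  have ho : Odd (2 * κ + 1).natAbs := Int.natAbs_odd.2 ⟨κ, rfl⟩
  have h : smoothingFactor (!!decide (0 ≤ κ)) + loopValue * smoothingFactor (!decide (0 ≤ κ)) =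
      -T (if 0 ≤ κ then -3 else 3) := by
    by_cases h : 0 ≤ κ
    · simp only [smoothingFactor, h, loopValue, sub_mul, neg_mul, ← T_add]
      simp
      ring
    · simp only [smoothingFactor, h, loopValue, sub_mul, neg_mul, ← T_add]
      simp
  rw [h, ho.neg_pow, T_pow]
  congr 2
  split_ifs <;> push_cast <;> [rw [abs_of_nonneg (by omega)]; rw [abs_of_neg (by omega)]] <;> ring

/-- This makes the number of outer circles multiplicative over the columns. The product alone would
give 1 instead of `loopValue ^ 2` when all columns are cut; the second term, supported there,
corrects this. -/
theorem card_arcs {m : ℕ} [NeZero m] (z : Fin m → Prop) [DecidablePred z] :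
    loopValue ^ Nat.card (Quot (ArcJoined z)) =
      ∏ i, (if z i then loopValue else 1) +
        (loopValue ^ 2 - 1) * ∏ i, if z i then 0 else 1 := by
  by_cases h : ∃ i, z i
  · rw [card_arcs_of_exists h, Finset.prod_ite, Finset.prod_const, Finset.prod_const_one]
    obtain ⟨i, hi⟩ := h
    have h0 : ∏ i, (if z i then (0 : ℤ[T;T⁻¹]) else 1) = 0 :=
      Finset.prod_eq_zero (Finset.mem_univ i) (if_pos hi)
    rw [h0, Nat.card_eq_fintype_card,
      Fintype.card_subtype]
    ring
  · push Not at h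
    rw [card_arcs_of_forall_not h]
    simp [h]

theorem card_arcs_pos {m : ℕ} [NeZero m] (z : Fin m → Prop) :
    0 < Nat.card (Quot (ArcJoined z)) := by
  by_cases h : ∃ i, z i
  · rw [card_arcs_of_exists h]
    have : Nonempty {i // z i} := ⟨⟨_, h.choose_spec⟩⟩
    exact Nat.card_pos
  · push Not at h
    rw [card_arcs_of_forall_not h]
    exact two_pos

theorem T_sum {ι : Type*} (s : Finset ι) (f : ι → ℤ) :
    (T (∑ i ∈ s, f i) : ℤ[T;T⁻¹]) = ∏ i ∈ s, T (f i) := by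
  classical
  induction s using Finset.induction_on with
  | empty => simp
  | insert a s ha ih => rw [Finset.sum_insert ha, Finset.prod_insert ha, T_add, ih]

/-- The weight of a state factors over the columns by `circles_eq` and `card_arcs`, so the sum over
the states is a product of column sums. The extra `loopValue` compensates for the exponent `circles
- 1`. -/
theorem loopValue_mul_bracket {g : ℕ} (k : Fin (2 * g + 1) → ℤ) :
    loopValue * (pretzelKnot k).bracket =
      ∏ i, (T (2 * k i + 1) * loopValue + columnBracket (k i)) +
        (loopValue ^ 2 - 1) * ∏ i, columnBracket (k i) := by
  have h1 : ∏ i, (T (2 * k i + 1) * loopValue + columnBracket (k i)) =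
      ∑ σ : PretzelCrossing k → Bool, ∏ i, ((∏ j, smoothingFactor (σ ⟨i, j⟩)) *
        loopValue ^ (allCuts (IsCut k σ) i - 1) *
          if allCuts (IsCut k σ) i = 0 then loopValue else 1) := by
    simp only [allCuts_eq]
    rw [sum_states_prod _ fun i (τ : Fin (2 * k i + 1).natAbs → Bool) =>
      (∏ j, smoothingFactor (τ j)) * loopValue ^ (columnCuts (!decide (0 ≤ k i)) τ - 1) *
          if columnCuts (!decide (0 ≤ k i)) τ = 0 then loopValue else 1]
    refine Finset.prod_congr rfl fun i _ => ?_
    rw [sum_column, smoothingFactor_pow]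
    rfl
  have h2 : ∏ i, columnBracket (k i) =
      ∑ σ : PretzelCrossing k → Bool, ∏ i, ((∏ j, smoothingFactor (σ ⟨i, j⟩)) *
        loopValue ^ (allCuts (IsCut k σ) i - 1) *
          if allCuts (IsCut k σ) i = 0 then 0 else 1) := by
    simp only [allCuts_eq]
    rw [sum_states_prod _ fun i (τ : Fin (2 * k i + 1).natAbs → Bool) =>
      (∏ j, smoothingFactor (τ j)) * loopValue ^ (columnCuts (!decide (0 ≤ k i)) τ - 1) *
          if columnCuts (!decide (0 ≤ k i)) τ = 0 then 0 else 1]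
    refine Finset.prod_congr rfl fun i _ => Finset.sum_congr rfl fun τ _ => ?_
    split_ifs <;> ring
  rw [h1, h2, KnotDiagram.bracket, Finset.mul_sum, Finset.mul_sum, ← Finset.sum_add_distrib]
  refine Finset.sum_congr rfl fun σ _ => ?_
  have hT : (T (∑ c, if σ c = true then 1 else -1) : ℤ[T;T⁻¹]) =
      ∏ i, ∏ j, smoothingFactor (σ ⟨i, j⟩) := by
    rw [T_sum, Fintype.prod_sigma]
    rfl
  have hpow : loopValue * loopValue ^ ((pretzelKnot k).circles σ - 1) =
      (∏ i, loopValue ^ (allCuts (IsCut k σ) i - 1)) *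
        loopValue ^ Nat.card (Quot (ArcJoined fun i => allCuts (IsCut k σ) i = 0)) := by
    rw [← pow_succ', Finset.prod_pow_eq_pow_sum, ← pow_add, circles_eq]
    congr 1
    -- There is at least one circle, so the truncated subtraction is exact.
    have := card_arcs_pos fun i => allCuts (IsCut k σ) i = 0
    omega
  rw [mul_left_comm, hpow, hT, card_arcs]
  simp only [Finset.prod_mul_distrib]
  ring

/-! ### Writhe and Jones polynomial of a pretzel knot -/

theorem pretzelKnot_writhe {g : ℕ} (k : Fin (2 * g + 1) → ℤ) :
    (pretzelKnot k).writhe = -∑ i, (2 * k i + 1) := by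
  have h : ∀ c, ((pretzelKnot k).sign c : ℤ) = if 0 ≤ k c.1 then -1 else 1 := by
    intro c
    change (((if 0 ≤ k c.1 then (-1 : ℤˣ) else 1) : ℤˣ) : ℤ) = _
    split_ifs <;> rfl
  rw [writhe, Fintype.sum_sigma, ← Finset.sum_neg_distrib]
  refine Finset.sum_congr rfl fun i _ => ?_
  simp only [h]
  split_ifs <;>
    simp only [Finset.sum_const, Finset.card_univ, Fintype.card_fin, nsmul_eq_mul] <;> omega

theorem pretzelKnot_negOnePow_writhe {g : ℕ} (k : Fin (2 * g + 1) → ℤ) :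
    ((pretzelKnot k).writhe.negOnePow : ℤ) = -1 := by
  have h : Odd (pretzelKnot k).writhe := by
    rw [pretzelKnot_writhe]
    refine Odd.neg ⟨∑ i, k i + g, ?_⟩
    rw [Finset.sum_add_distrib, ← Finset.mul_sum]
    simp
    ring
  rw [Int.negOnePow_odd _ h]
  rfl

theorem one_add_T_neg_one_dvd (κ : ℤ) :
    (1 + T (-1) : ℤ[T;T⁻¹]) ∣ 1 + T (-(2 * κ + 1)) := by
  have h : ∀ a : ℕ, (1 + T (-1) : ℤ[T;T⁻¹]) ∣ 1 + T (-(2 * a + 1)) := by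
    intro a
    have := Odd.add_dvd_pow_add_pow (1 : ℤ[T;T⁻¹]) (T (-1)) (n := 2 * a + 1) ⟨a, rfl⟩
    rw [one_pow, T_pow] at this
    convert this using 3
    push_cast
    ring
  by_cases h0 : 0 ≤ κ
  · obtain ⟨a, rfl⟩ := Int.eq_ofNat_of_zero_le h0
    exact h a
  · obtain ⟨a, rfl⟩ : ∃ a : ℕ, κ = -(a : ℤ) - 1 := ⟨(-κ - 1).toNat, by omega⟩
    have e : (1 + T (-(2 * (-(a : ℤ) - 1) + 1)) : ℤ[T;T⁻¹]) =
        T (2 * a + 1) * (1 + T (-(2 * a + 1))) := by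
      rw [mul_add, mul_one, ← T_add, add_neg_cancel, T_zero, add_comm]
      congr 2
      ring
    rw [e]
    exact Dvd.dvd.mul_left (h a) _

theorem one_add_T_ne_zero (n : ℤ) : (1 + T n : ℤ[T;T⁻¹]) ≠ 0 := by
  intro h
  have := congrArg evalOneHom h
  simp at this

/-- The point is divisibility: the left-hand factor is `(t y²)^(g+1)` with `y = 1 + t⁻¹`. The
factors on the right are `y (q i - p i)` and `y q i`, which accounts for `y^(2g+1)`; `hdvd` supplies
the last factor `y`. -/
theorem exists_isJonesPolynomial {g : ℕ} (k : Fin (2 * g + 1) → ℤ) :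
    ∃ V, (pretzelKnot k).IsJonesPolynomial V ∧
      (T 1 + 2 + T (-1)) ^ (g + 1) * V =
        ∏ i, (1 - (T 1 + 1 + T (-1)) * T (-(2 * k i + 1))) +
          (T 1 + 1 + T (-1)) * ∏ i, (1 + T (-(2 * k i + 1))) := by
  choose q hq using fun i => one_add_T_neg_one_dvd (k i)
  have hpow : ∀ (x : ℤ[T;T⁻¹]) (f : Fin (2 * g + 1) → ℤ[T;T⁻¹]),
      x ^ (2 * g + 1) * ∏ i, f i = ∏ i, x * f i := by
    intro x f
    rw [Finset.prod_mul_distrib, Finset.prod_const, Finset.card_univ, Fintype.card_fin]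
  set y : ℤ[T;T⁻¹] := 1 + T (-1) with hy
  have hy0 : y ≠ 0 := one_add_T_ne_zero _
  have hTT : (T 1 * T (-1) : ℤ[T;T⁻¹]) = 1 := by rw [← T_add]; rfl
  set p : Fin (2 * g + 1) → ℤ[T;T⁻¹] := fun i => T 1 * T (-(2 * k i + 1)) * y with hp
  -- Modulo `y` every `p i` vanishes, so the two products agree and occur with total coefficient `t
  -- + 2 + t⁻¹ = t y²`.
  have hdvd : y ∣ ∏ i, (q i - p i) + (T 1 + 1 + T (-1)) * ∏ i, q i := by
    have h1 : y ∣ ∏ i, (q i - p i) - ∏ i, q i := by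
      rw [← Ideal.mem_span_singleton, ← Ideal.Quotient.eq, map_prod, map_prod]
      refine Finset.prod_congr rfl fun i _ => ?_
      rw [Ideal.Quotient.eq, Ideal.mem_span_singleton]
      exact ⟨-(T 1 * T (-(2 * k i + 1))), by rw [hp]; ring⟩
    have h2 : y ∣ (1 + (T 1 + 1 + T (-1))) * ∏ i, q i := by
      refine Dvd.dvd.mul_right ⟨T 1 * y, ?_⟩ _
      rw [hy]
      linear_combination (-2 - T (-1)) * hTT
    have := dvd_add h1 h2
    convert this using 1
    ring
  obtain ⟨Q, hQ⟩ := hdvd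
  refine ⟨T (-(g + 1)) * Q, ?_, ?_⟩
  -- With `t = A^(-4)` the circle value is `-A^(-2) S y`. The powers of `A` from the writhe are
  -- distributed over the columns, one factor `A^(3 n_i)` each.
  · set S := substPowHom (-4) with hS
    have hSy : S y = 1 + T 4 := by
      rw [hy, map_add, map_one, substPowHom_T]
      rfl
    have hSy0 : S y ≠ 0 := by
      rw [hSy]
      exact one_add_T_ne_zero _
    have hloop : loopValue = -T (-2) * S y := by
      rw [hSy, mul_add, neg_mul, neg_mul, ← T_add]
      simp only [loopValue]
      norm_num
      ring
    have hSq : ∀ i, S y * S (q i) = 1 + T (4 * (2 * k i + 1)) := by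
      intro i
      rw [← map_mul, ← hq, map_add, map_one, substPowHom_T]
      congr 2
      ring
    -- the normalized brackets of the columns
    have hB : ∀ i, T (3 * (2 * k i + 1)) * columnBracket (k i) = T 2 * S (q i) := by
      intro i
      have h1 := loopValue_mul_columnBracket (k i)
      refine mul_left_cancel₀ (mul_ne_zero (neg_ne_zero.2 (isUnit_T (-2)).ne_zero) hSy0) ?_
      rw [← hloop]
      have e1 : (T (3 * (2 * k i + 1)) * T (-3 * (2 * k i + 1)) : ℤ[T;T⁻¹]) = 1 := by
        rw [← T_add, ← T_zero]; congr 1; ring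
      have e2 : (T (3 * (2 * k i + 1)) * T (2 * k i + 1) : ℤ[T;T⁻¹]) =
          T (4 * (2 * k i + 1)) := by
        rw [← T_add]; congr 1; ring
      have e3 : (T (-2) * T 2 : ℤ[T;T⁻¹]) = 1 := by rw [← T_add]; rfl
      linear_combination T (3 * (2 * k i + 1)) * h1 - e1 + hSq i - e2 +
        S y * S (q i) * e3 - T 2 * S (q i) * hloop
    have hTT2 : (T (-2) * T 2 : ℤ[T;T⁻¹]) = 1 := by rw [← T_add]; rfl
    have hprod1 : (∏ i, T (3 * (2 * k i + 1))) *
        ∏ i, (T (2 * k i + 1) * loopValue + columnBracket (k i)) =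
          T 2 ^ (2 * g + 1) * S (∏ i, (q i - p i)) := by
      rw [map_prod, hpow, ← Finset.prod_mul_distrib]
      refine Finset.prod_congr rfl fun i _ => ?_
      have e2 : (T (3 * (2 * k i + 1)) * T (2 * k i + 1) : ℤ[T;T⁻¹]) =
          T (4 * (2 * k i + 1)) := by
        rw [← T_add]; congr 1; ring
      have e3 : (T 2 * T (-4) : ℤ[T;T⁻¹]) = T (-2) := by rw [← T_add]; rfl
      have e4 : S (p i) = T (-4) * T (4 * (2 * k i + 1)) * S y := by
        rw [hp, map_mul, map_mul, substPowHom_T, substPowHom_T]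
        congr 3
        ring
      rw [mul_add, hB, hloop, map_sub, e4]
      linear_combination (-T (-2) * S y) * e2 + T (4 * (2 * k i + 1)) * S y * e3
    have hprod2 : (∏ i, T (3 * (2 * k i + 1))) * ∏ i, columnBracket (k i) =
        T 2 ^ (2 * g + 1) * S (∏ i, q i) := by
      rw [map_prod, hpow, ← Finset.prod_mul_distrib]
      exact Finset.prod_congr rfl fun i _ => hB i
    have hloop2 : loopValue ^ 2 - 1 = S (T 1 + 1 + T (-1)) := by
      rw [map_add, map_add, map_one, substPowHom_T, substPowHom_T]
      have e1 : (T 4 : ℤ[T;T⁻¹]) = T 2 * T 2 := by rw [← T_add]; rfl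
      have e2 : (T (-4) : ℤ[T;T⁻¹]) = T (-2) * T (-2) := by rw [← T_add]; rfl
      norm_num
      rw [e1, e2]
      linear_combination 2 * hTT2
    have hmain := loopValue_mul_bracket k
    have hSQ : T 2 ^ (2 * g + 1) * (S y * S Q) =
        (∏ i, T (3 * (2 * k i + 1))) * (loopValue * (pretzelKnot k).bracket) := by
      rw [hmain, ← map_mul, ← hQ, map_add, map_mul, ← hloop2]
      linear_combination (-1 : ℤ[T;T⁻¹]) * hprod1 - (loopValue ^ 2 - 1) * hprod2
    have hTg : (T (-4 * -((g : ℤ) + 1)) : ℤ[T;T⁻¹]) = T 2 * T 2 ^ (2 * g + 1) := by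
      rw [← pow_succ', T_pow]
      congr 1
      push_cast
      ring
    have hw : (T (-3 * (pretzelKnot k).writhe) : ℤ[T;T⁻¹]) = ∏ i, T (3 * (2 * k i + 1)) := by
      rw [pretzelKnot_writhe, neg_mul_neg, Finset.mul_sum, T_sum]
    rw [IsJonesPolynomial, ← substPowHom_apply, map_mul, substPowHom_T, hTg,
      pretzelKnot_negOnePow_writhe, hw, neg_smul, one_smul]
    refine mul_left_cancel₀ hSy0 ?_
    rw [hloop] at hSQ
    linear_combination T 2 * hSQ - S y * (∏ i, T (3 * (2 * k i + 1))) *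
      (pretzelKnot k).bracket * hTT2
  · have h1 : y ^ (2 * g + 1) * ∏ i, (q i - p i) =
        ∏ i, (1 - (T 1 + 1 + T (-1)) * T (-(2 * k i + 1))) := by
      rw [hpow]
      refine Finset.prod_congr rfl fun i _ => ?_
      rw [mul_sub, ← hq, hp, hy]
      linear_combination (-T (-(2 * k i + 1)) * (2 + T (-1))) * hTT
    have h2 : y ^ (2 * g + 1) * ∏ i, q i = ∏ i, (1 + T (-(2 * k i + 1))) := by
      rw [hpow]
      exact Finset.prod_congr rfl fun i _ => (hq i).symm
    have h3 : (T 1 + 2 + T (-1) : ℤ[T;T⁻¹]) = T 1 * y ^ 2 := by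
      rw [hy]
      linear_combination (-2 - T (-1)) * hTT
    have h4 : (T 1 ^ (g + 1) * T (-(g + 1)) : ℤ[T;T⁻¹]) = 1 := by
      rw [T_pow, ← T_add, ← T_zero]
      congr 1
      push_cast
      ring
    rw [← h1, ← h2, h3, mul_pow, ← pow_mul]
    linear_combination y ^ (2 * (g + 1)) * Q * h4 - y ^ (2 * g + 1) * hQ

/-! ### The invariant `v₃` -/

section Newton

variable {m : ℕ} (k : Fin m → ℤ)

theorem eval_esymm_eq_elemSymm (n : ℕ) :
    MvPolynomial.eval k (MvPolynomial.esymm (Fin m) ℤ n) = elemSymm n k := by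
  simp [MvPolynomial.esymm, elemSymm]

theorem eval_psum_eq_sum (n : ℕ) :
    MvPolynomial.eval k (MvPolynomial.psum (Fin m) ℤ n) = ∑ i, k i ^ n := by
  simp [MvPolynomial.psum]

theorem elemSymm_one : elemSymm 1 k = ∑ i, k i := by
  simp [elemSymm, Finset.powersetCard_one]

theorem two_mul_elemSymm_two : 2 * elemSymm 2 k = elemSymm 1 k ^ 2 - ∑ i, k i ^ 2 := by
  have := congrArg (MvPolynomial.eval k) (MvPolynomial.mul_esymm_eq_sum (Fin m) ℤ 2)
  rw [show (Finset.HasAntidiagonal.antidiagonal 2).filter (fun a => a.1 < 2) =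
    {(0, 2), (1, 1)} by decide] at this
  simp [eval_esymm_eq_elemSymm, eval_psum_eq_sum] at this
  rw [elemSymm_one]
  linarith

theorem three_mul_elemSymm_three :
    3 * elemSymm 3 k = elemSymm 2 k * elemSymm 1 k - elemSymm 1 k * ∑ i, k i ^ 2 +
      ∑ i, k i ^ 3 := by
  have := congrArg (MvPolynomial.eval k) (MvPolynomial.mul_esymm_eq_sum (Fin m) ℤ 3)
  rw [show (Finset.HasAntidiagonal.antidiagonal 3).filter (fun a => a.1 < 3) =
    {(0, 3), (1, 2), (2, 1)} by decide] at this
  simp [eval_esymm_eq_elemSymm, eval_psum_eq_sum] at this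
  rw [elemSymm_one]
  linarith

end Newton

/-! ### Expansion at `t = exp X` up to order three -/

namespace PowerSeries

/-- The beginning of the power series `f` is that of `u * exp (a X + b X ^ 2 + c X ^ 3)`. -/
structure IsExpJet (f : ℚ⟦X⟧) (u a b c : ℚ) : Prop where
  coeff_zero : coeff 0 f = u
  coeff_one : coeff 1 f = u * a
  coeff_two : coeff 2 f = u * (b + a ^ 2 / 2)
  coeff_three : coeff 3 f = u * (c + a * b + a ^ 3 / 6)

theorem coeff_mul_one (f g : ℚ⟦X⟧) :
    coeff 1 (f * g) = coeff 0 f * coeff 1 g + coeff 1 f * coeff 0 g := by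
  rw [coeff_mul, Finset.Nat.sum_antidiagonal_eq_sum_range_succ
    (f := fun a b => coeff a f * coeff b g)]
  simp [Finset.sum_range_succ]

theorem coeff_mul_two (f g : ℚ⟦X⟧) :
    coeff 2 (f * g) = coeff 0 f * coeff 2 g + coeff 1 f * coeff 1 g + coeff 2 f * coeff 0 g := by
  rw [coeff_mul, Finset.Nat.sum_antidiagonal_eq_sum_range_succ
    (f := fun a b => coeff a f * coeff b g)]
  simp [Finset.sum_range_succ]

theorem coeff_mul_three (f g : ℚ⟦X⟧) :
    coeff 3 (f * g) = coeff 0 f * coeff 3 g + coeff 1 f * coeff 2 g + coeff 2 f * coeff 1 g +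
      coeff 3 f * coeff 0 g := by
  rw [coeff_mul, Finset.Nat.sum_antidiagonal_eq_sum_range_succ
    (f := fun a b => coeff a f * coeff b g)]
  simp [Finset.sum_range_succ]

theorem coeff_mul_zero (f g : ℚ⟦X⟧) : coeff 0 (f * g) = coeff 0 f * coeff 0 g := by
  simp

namespace IsExpJet

theorem one : IsExpJet 1 1 0 0 0 := by
  constructor <;> simp [PowerSeries.coeff_one]

/-- Exponents of exponentials add. Hence products over the columns become sums, and only power sums
of the `n_i` enter. -/
theorem mul {f g : ℚ⟦X⟧} {u a b c u' a' b' c' : ℚ} (h : IsExpJet f u a b c)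
    (h' : IsExpJet g u' a' b' c') :
    IsExpJet (f * g) (u * u') (a + a') (b + b') (c + c') := by
  obtain ⟨h0, h1, h2, h3⟩ := h
  obtain ⟨h0', h1', h2', h3'⟩ := h'
  constructor
  · rw [coeff_mul_zero, h0, h0']
  · rw [coeff_mul_one, h0, h0', h1, h1']
    ring
  · rw [coeff_mul_two, h0, h0', h1, h1', h2, h2']
    ring
  · rw [coeff_mul_three, h0, h0', h1, h1', h2, h2', h3, h3']
    ring

theorem prod {ι : Type*} (s : Finset ι) {f : ι → ℚ⟦X⟧} {u a b c : ι → ℚ}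
    (h : ∀ i, IsExpJet (f i) (u i) (a i) (b i) (c i)) :
    IsExpJet (∏ i ∈ s, f i) (∏ i ∈ s, u i) (∑ i ∈ s, a i) (∑ i ∈ s, b i) (∑ i ∈ s, c i) := by
  classical
  induction s using Finset.induction_on with
  | empty => simpa using one
  | insert i s hi ih =>
    simpa [Finset.prod_insert hi, Finset.sum_insert hi] using (h i).mul ih

end IsExpJet

end PowerSeries

namespace KnotDiagram

open PowerSeries

/-- The homomorphism that sends a Laurent polynomial `f(t)` to the power series `f(exp X)`. -/
noncomputable def expSubst : ℤ[T;T⁻¹] →ₐ[ℤ] ℚ⟦X⟧ :=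
  AddMonoidAlgebra.lift ℤ ℚ⟦X⟧ ℤ
    { toFun := fun n => rescale ((n.toAdd : ℤ) : ℚ) (exp ℚ)
      map_one' := by simp
      map_mul' := fun a b => by
        rw [exp_mul_exp_eq_exp_add, toAdd_mul, Int.cast_add] }

theorem expSubst_T (n : ℤ) : expSubst (T n) = rescale (n : ℚ) (exp ℚ) := by
  exact (AddMonoidAlgebra.lift_single _ _ _).trans (one_smul ℤ _)

theorem isExpJet_expSubst_T (n : ℤ) : IsExpJet (expSubst (T n)) 1 n 0 0 := by
  rw [expSubst_T]
  constructor <;> simp [coeff_rescale, coeff_exp, Nat.factorial] <;> ring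

theorem derivative_add (f h : ℤ[T;T⁻¹]) :
    derivative (f + h) = derivative f + derivative h := by
  rw [derivative, AddMonoidAlgebra.coeff_add, Finsupp.sum_add_index']
  · rfl
  · intro n
    rw [mul_zero, zero_smul]
  · intro n a b
    rw [mul_add, add_smul]

theorem derivative_C_mul_T (a n : ℤ) :
    derivative (LaurentPolynomial.C a * T n) = LaurentPolynomial.C (n * a) * T (n - 1) := by
  rw [← single_eq_C_mul_T, derivative, AddMonoidAlgebra.coeff_single, Finsupp.sum_single_index,
    LaurentPolynomial.smul_eq_C_mul]
  rw [mul_zero, zero_smul]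

theorem evalOneHom_C (a : ℤ) : evalOneHom (LaurentPolynomial.C a) = a := by
  simp [evalOneHom]

/-- The coefficient of `X^j` in `exp (n X)` is `n^j / j!`; expand `n (n - 1)` and `n (n - 1) (n -
2)` in powers of `n`. -/
theorem evalOne_derivatives (V : ℤ[T;T⁻¹]) :
    (evalOne (derivative^[2] V) : ℚ) =
        2 * coeff 2 (expSubst V) - coeff 1 (expSubst V) ∧
      (evalOne (derivative^[3] V) : ℚ) =
        6 * coeff 3 (expSubst V) - 6 * coeff 2 (expSubst V) + 2 * coeff 1 (expSubst V) := by
  simp only [Function.iterate_succ, Function.iterate_zero, Function.comp_apply, id_eq,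
    ← evalOneHom_apply]
  induction V using LaurentPolynomial.induction_on' with
  | add p q hp hq =>
    obtain ⟨h1, h2⟩ := hp
    obtain ⟨h3, h4⟩ := hq
    simp only [derivative_add, map_add, Int.cast_add, h1, h2, h3, h4]
    constructor <;> ring
  | C_mul_T n a =>
    obtain ⟨-, h1, h2, h3⟩ := isExpJet_expSubst_T n
    have hC : expSubst (LaurentPolynomial.C a * T n) = (a : ℚ) • expSubst (T n) := by
      rw [← LaurentPolynomial.smul_eq_C_mul, map_smul, Int.cast_smul_eq_zsmul]
    rw [hC]
    simp only [derivative_C_mul_T, map_mul evalOneHom, evalOneHom_C, evalOneHom_T, coeff_smul, h1,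
      h2, h3, smul_eq_mul]
    push_cast
    constructor <;> ring

/-- The coefficients -1/36 and -1/12 are such that the contributions of `X²` cancel. -/
theorem v₃_eq {C : Type} [Fintype C] [DecidableEq C] {D : KnotDiagram C} {V : ℤ[T;T⁻¹]}
    (hV : D.IsJonesPolynomial V) :
    D.v₃ = -coeff 3 (expSubst V) / 6 + coeff 1 (expSubst V) / 36 := by
  have h : D.jonesPolynomial = V :=
    (Classical.epsilon_spec ⟨V, hV⟩ : D.IsJonesPolynomial _).unique hV
  obtain ⟨h2, h3⟩ := evalOne_derivatives V
  rw [v₃, h, h2, h3]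
  ring

end KnotDiagram

open PowerSeries in
theorem v₃_of_functional_equation {g : ℕ} (k : Fin (2 * g + 1) → ℤ) {V : ℤ[T;T⁻¹]}
    (hV : (T 1 + 2 + T (-1)) ^ (g + 1) * V =
      ∏ i, (1 - (T 1 + 1 + T (-1)) * T (-(2 * k i + 1))) +
        (T 1 + 1 + T (-1)) * ∏ i, (1 + T (-(2 * k i + 1)))) :
    coeff 1 (expSubst V) = 0 ∧ coeff 3 (expSubst V) =
      3 * ((g : ℚ) * (g + 1) * (2 * g + 1) / 3
      + g * (2 * g + 1) * elemSymm 1 k + g * (elemSymm 1 k : ℚ) ^ 2 + 2 * g * elemSymm 2 k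
      + elemSymm 1 k * elemSymm 2 k + elemSymm 3 k) := by
  have hV := congrArg expSubst hV
  simp only [map_add, map_mul, map_sub, map_prod, map_pow, map_one, map_ofNat] at hV
  obtain ⟨a0, a1, a2, a3⟩ := isExpJet_expSubst_T 1
  obtain ⟨b0, b1, b2, b3⟩ := isExpJet_expSubst_T (-1)
  have hc : ∀ (n : ℕ), coeff n (1 : ℚ⟦X⟧) = if n = 0 then 1 else 0 := fun n =>
    PowerSeries.coeff_one n
  have hc2 : ∀ (n : ℕ), coeff n (2 : ℚ⟦X⟧) = if n = 0 then 2 else 0 := fun n => by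
    rw [← one_add_one_eq_two, map_add, hc]
    split_ifs <;> norm_num
  -- This is `1 + 2 cosh X = 3 + X² + …`; likewise the factor in `hF` is `2 + 2 cosh X = 4 cosh² (X
  -- / 2)`, whose logarithm starts with `log 4 + X² / 4`.
  set W : ℚ⟦X⟧ := expSubst (T 1) + 1 + expSubst (T (-1)) with hW
  have w0 : coeff 0 W = 3 := by rw [hW, map_add, map_add, a0, b0, hc]; norm_num
  have w1 : coeff 1 W = 0 := by rw [hW, map_add, map_add, a1, b1, hc]; norm_num
  have w2 : coeff 2 W = 1 := by rw [hW, map_add, map_add, a2, b2, hc]; norm_num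
  have w3 : coeff 3 W = 0 := by rw [hW, map_add, map_add, a3, b3, hc]; norm_num
  have hF : IsExpJet (expSubst (T 1) + 2 + expSubst (T (-1))) 4 0 (1 / 4) 0 := by
    constructor
    · rw [map_add, map_add, a0, b0, hc2]; norm_num
    · rw [map_add, map_add, a1, b1, hc2]; norm_num
    · rw [map_add, map_add, a2, b2, hc2]; norm_num
    · rw [map_add, map_add, a3, b3, hc2]; norm_num
  have hFp := IsExpJet.prod (Finset.range (g + 1)) fun _ => hF
  set n : Fin (2 * g + 1) → ℚ := fun i => 2 * k i + 1 with hn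
  have hA : ∀ i, IsExpJet (1 - W * expSubst (T (-(2 * k i + 1)))) (-2) (-3 / 2 * n i)
      (1 / 2 - 3 / 8 * n i ^ 2) ((n i - n i ^ 3) / 4) := by
    intro i
    obtain ⟨h0, h1, h2, h3⟩ := isExpJet_expSubst_T (-(2 * k i + 1))
    have e : ((-(2 * k i + 1) : ℤ) : ℚ) = -n i := by rw [hn]; push_cast; ring
    rw [e] at h1 h2 h3
    constructor
    · rw [map_sub, coeff_mul_zero, h0, w0, hc]; norm_num
    · rw [map_sub, coeff_mul_one, h0, h1, w0, w1, hc]; norm_num; ring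
    · rw [map_sub, coeff_mul_two, h0, h1, h2, w0, w1, w2, hc]; norm_num; ring
    · rw [map_sub, coeff_mul_three, h0, h1, h2, h3, w0, w1, w2, w3, hc]; norm_num; ring
  have hB : ∀ i, IsExpJet (1 + expSubst (T (-(2 * k i + 1)))) 2 (-1 / 2 * n i)
      (1 / 8 * n i ^ 2) 0 := by
    intro i
    obtain ⟨h0, h1, h2, h3⟩ := isExpJet_expSubst_T (-(2 * k i + 1))
    have e : ((-(2 * k i + 1) : ℤ) : ℚ) = -n i := by rw [hn]; push_cast; ring
    rw [e] at h1 h2 h3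
    constructor
    · rw [map_add, h0, hc]; norm_num
    · rw [map_add, h1, hc]; norm_num; ring
    · rw [map_add, h2, hc]; norm_num; ring
    · rw [map_add, h3, hc]; norm_num; ring
  have hAp := IsExpJet.prod Finset.univ hA
  have hBp := IsExpJet.prod Finset.univ hB
  simp only [Finset.prod_const, Finset.sum_const, Finset.card_univ, Fintype.card_fin,
    Finset.card_range, nsmul_eq_mul, Finset.sum_sub_distrib, ← Finset.mul_sum, ← Finset.sum_div]
    at hFp hAp hBp
  obtain ⟨f0, f1, f2, f3⟩ := hFp
  obtain ⟨p0, p1, p2, p3⟩ := hAp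
  obtain ⟨q0, q1, q2, q3⟩ := hBp
  -- The number of columns is odd, so the constant terms on the right are `-2^m` and `3 * 2^m`,
  -- which add up to `4^(g+1)`. The terms linear in the `n_i` then cancel in degree one.
  have hu : (-2 : ℚ) ^ (2 * g + 1) = -2 ^ (2 * g + 1) := Odd.neg_pow ⟨g, rfl⟩ _
  have hu4 : (4 : ℚ) ^ (g + 1) = 2 * 2 ^ (2 * g + 1) := by
    rw [← pow_succ', show 2 * g + 1 + 1 = 2 * (g + 1) by ring, pow_mul]
    norm_num
  have hu0 : (2 : ℚ) ^ (2 * g + 1) ≠ 0 := by positivity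
  rw [hu] at p0 p1 p2 p3
  rw [hu4] at f0 f1 f2 f3
  have c1 := congrArg (coeff 1) hV
  have c3 := congrArg (coeff 3) hV
  -- The factor of `V` is even in `X`, so the coefficients of `1` and `X²` in `V` do not enter.
  rw [map_add, coeff_mul_one, coeff_mul_one, f0, f1, p1, q0, q1, w0, w1] at c1
  rw [map_add, coeff_mul_three, coeff_mul_three, f0, f1, f2, f3, p3, q0, q1, q2, q3, w0, w1, w2,
    w3] at c3
  have r1 : coeff 1 (expSubst V) = 0 := by
    refine mul_left_cancel₀ hu0 ?_
    linear_combination c1 / 2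
  refine ⟨r1, ?_⟩
  rw [r1] at c3
  -- The power sums of `n_i = 2 k_i + 1` come from those of the `k_i`, which Newton's identities
  -- express by elementary symmetric polynomials.
  have s1 : ∑ i, n i = 2 * elemSymm 1 k + (2 * g + 1) := by
    rw [hn, Finset.sum_add_distrib, ← Finset.mul_sum, elemSymm_one]
    simp
  have s2 : ∑ i, n i ^ 2 = 4 * ((elemSymm 1 k : ℚ) ^ 2 - 2 * elemSymm 2 k) + 4 * elemSymm 1 k +
      (2 * g + 1) := by
    have h2 : (2 : ℚ) * elemSymm 2 k = (elemSymm 1 k : ℚ) ^ 2 - ∑ i, (k i : ℚ) ^ 2 := by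
      exact_mod_cast two_mul_elemSymm_two k
    have e : ∀ i, n i ^ 2 = 4 * (k i : ℚ) ^ 2 + 4 * k i + 1 := fun i => by rw [hn]; ring
    rw [h2, Finset.sum_congr rfl fun i _ => e i, Finset.sum_add_distrib, Finset.sum_add_distrib,
      ← Finset.mul_sum, ← Finset.mul_sum, elemSymm_one]
    simp
  have s3 : ∑ i, n i ^ 3 = 8 * (3 * elemSymm 3 k - elemSymm 2 k * elemSymm 1 k + elemSymm 1 k *
        ((elemSymm 1 k : ℚ) ^ 2 - 2 * elemSymm 2 k)) +
      12 * ((elemSymm 1 k : ℚ) ^ 2 - 2 * elemSymm 2 k) + 6 * elemSymm 1 k + (2 * g + 1) := by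
    have h2 : (2 : ℚ) * elemSymm 2 k = (elemSymm 1 k : ℚ) ^ 2 - ∑ i, (k i : ℚ) ^ 2 := by
      exact_mod_cast two_mul_elemSymm_two k
    have h3 : (3 : ℚ) * elemSymm 3 k = elemSymm 2 k * elemSymm 1 k -
        elemSymm 1 k * ∑ i, (k i : ℚ) ^ 2 + ∑ i, (k i : ℚ) ^ 3 := by
      exact_mod_cast three_mul_elemSymm_three k
    have e : ∀ i, n i ^ 3 = 8 * (k i : ℚ) ^ 3 + 12 * (k i : ℚ) ^ 2 + 6 * k i + 1 := fun i => by
      rw [hn]; ring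
    have h1 : (elemSymm 1 k : ℚ) = ∑ i, (k i : ℚ) := by exact_mod_cast elemSymm_one k
    have : ∑ i, n i ^ 3 = 8 * ∑ i, (k i : ℚ) ^ 3 + 12 * ∑ i, (k i : ℚ) ^ 2 +
        6 * ∑ i, (k i : ℚ) + (2 * g + 1) := by
      rw [Finset.sum_congr rfl fun i _ => e i]
      simp [Finset.sum_add_distrib, Finset.mul_sum]
    rw [this, h3, h2, ← h1]
    ring
  rw [s1, s2, s3] at c3
  refine mul_left_cancel₀ hu0 ?_
  push_cast at c3
  linear_combination c3 / 2

theorem lemma2p2 (g : ℕ) (k : Fin (2 * g + 1) → ℤ) :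
    ((pretzelKnot k).IsConwayPolynomial (pretzelKnot k).conwayPolynomial ∧
      (pretzelKnot k).IsJonesPolynomial (pretzelKnot k).jonesPolynomial) ∧
    ((pretzelKnot k).a₂ : ℚ) = 1 / 2 * g * (g + 1) + g * elemSymm 1 k + elemSymm 2 k ∧
    (pretzelKnot k).v₃ = -(1 / 2) * ((g : ℚ) * (g + 1) * (2 * g + 1) / 3
      + g * (2 * g + 1) * elemSymm 1 k + g * (elemSymm 1 k : ℚ) ^ 2 + 2 * g * elemSymm 2 k
      + elemSymm 1 k * elemSymm 2 k + elemSymm 3 k) := by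
  obtain ⟨V, hV, hfun⟩ := exists_isJonesPolynomial k
  have hP := pretzelKnot_isConwayPolynomial k
  -- Existence makes the chosen polynomial a genuine Conway polynomial, and uniqueness identifies it
  -- with `pretzelConway k`. `v₃_eq` does the same for the Jones polynomial.
  have hC : (pretzelKnot k).IsConwayPolynomial (pretzelKnot k).conwayPolynomial :=
    Classical.epsilon_spec ⟨_, hP⟩
  obtain ⟨h1, h3⟩ := v₃_of_functional_equation k hfun
  refine ⟨⟨hC, Classical.epsilon_spec ⟨V, hV⟩⟩, ?_, ?_⟩
  · rw [KnotDiagram.a₂, hC.unique hP]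
    exact pretzelConway.coeff_two k
  · rw [KnotDiagram.v₃_eq hV, h1, h3]
    ring
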